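/- Let $D,R\in\{0,1\}$ be the treatment and response indicators, $X$ the covariates, $(Y(1),Y(0))$ real potential outcomes and $Y^{\rm obs}=Y(D)$, with outcomes observed only if $R=1$; so the observed data are $\mathcal O=(X,D,R,R\,Y^{\rm obs})$, with law $P$. Let $\mathcal C_0(x),\mathcal C_1(x)$ be fixed (measurable) prediction intervals for the potential outcomes, let $\mathcal C_{\rm ITE}=Y^{\rm obs}-\mathcal C_0(X)$ if $D=1$ and $\mathcal C_{\rm ITE}=\mathcal C_1(X)-Y^{\rm obs}$ if $D=0$, and let $V_{\mathcal C}=V(X,\mathcal C_{\rm ITE})$ for a fixed measurable real-valued score function $V$. Let $\gamma\in(0,1)$ and let $\eta=\eta_{\gamma,\mathcal C}$ be the $(1-\gamma)$-quantile of $V_{\mathcal C}$ given $R=0$. Assume: (i) (MAR) $(Y(1),Y(0))\perp\!\!\!\perp R\mid X,D$; (ii) (overlap) for some $c>0$, almost surely $c<\mathbb P(D=1\mid X)<1-c$ and $c<\mathbb P(R=1\mid X,D)<1-c$; (iii) $\mathbb E\big[\mathbb P(R=0\mid X,D)^2/\mathbb P(R=1\mid X,D)\big]<\infty$; (iv) the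 distribution function of $V_{\mathcal C}$ given $R=0$ is differentiable at $\eta$ with a strictly positive derivative (the density at $\eta$). For a law $Q$ of the observed data put $m_{\mathcal C,Q}(v,X,D)=Q(V_{\mathcal C}<v\mid X,D,R=1)$ and $\eta(Q)=\inf\{v:\mathbb E_Q[m_{\mathcal C,Q}(v,X,D)\mid R=0]\ge 1-\gamma\}$. Then for every law of $(X,D,R,Y(1),Y(0))$ satisfying (i) and (ii), the $(1-\gamma)$-quantile of $V_{\mathcal C}$ given $R=0$ equals $\eta(Q)$, where $Q$ is the induced law of the observed data; in particular $\eta=\eta(P)$. Moreover, with $m_{\mathcal C}=m_{\mathcal C,P}$ and $\pi_R(X,D)=\mathbb P(R=1\mid X,D)/\mathbb P(R=0\mid X,D)$, the efficient influence function of $\eta(\cdot)$ at $P$ is, up to a nonzero multiplicative constant, $$\psi_{\mathcal C}=(1-R)\big[m_{\mathcal C}(\eta,X,D)-(1-\gamma)\big]+\frac{R}{\pi_R(X,D)}\big[\mathbf 1\{V_{\mathcal C}<\eta\}-m_{\mathcal C}(\eta,X,D)\big].$$ That is, for some constant $\kappa\ne0$ the function $\psi=\kappa\,\psi_{\mathcal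 C}$ is, up to $P$-null sets, the unique square-integrable function of $\mathcal O$ with $\mathbb E_P[\psi]=0$ and $$\frac{d}{dt}\,\eta\big((1+ts)P\big)\Big|_{t=0}=\mathbb E_P[\psi(\mathcal O)s(\mathcal O)]$$ for every $s$ with $\mathbb E_P[s]=0$ and $\mathbb E_P[s^2]<\infty$, the derivative being taken along those $t$ for which $(1+ts)P$ is a probability measure (no condition if $t=0$ is the only one). No conditional independence of $D$ and $R$ given $X$ is assumed. -/

import Mathlib

open MeasureTheory ProbabilityTheory Set

noncomputable section

namespace Attrition

section Semiparametric

variable {𝒪 : Type*} [MeasurableSpace 𝒪]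

/-- The perturbation `P_t = (1 + t s) P` of a law `P` in the direction `s`. -/
def perturb (P : Measure 𝒪) (s : 𝒪 → ℝ) (t : ℝ) : Measure 𝒪 :=
  P.withDensity fun o => ENNReal.ofReal (1 + t * s o)

/-- The parameters `t` for which `(1 + t s) P` is a genuine (nonnegative) measure. If `s` has mean
zero these are the `t` for which it is a probability measure. If `s` is essentially bounded this is
a neighbourhood of `0`. -/
def validTimes (P : Measure 𝒪) (s : 𝒪 → ℝ) : Set ℝ :=
  {t | ∀ᵐ o ∂P, 0 ≤ 1 + t * s o}

/-- `ψ` is an influence function (a gradient) at `P` of the real parameter `θ` in the nonparametric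
model: it is square integrable with mean zero, and
`d/dt θ((1 + t s) P) |_{t = 0} = E_P[ψ s]` for every score `s` (square integrable, mean zero), the
derivative being taken along those `t` for which `(1 + t s) P` is a probability measure. -/
structure IsInfluenceFunction (θ : Measure 𝒪 → ℝ) (P : Measure 𝒪) (ψ : 𝒪 → ℝ) : Prop where
  memLp : MemLp ψ 2 P
  mean_zero : ∫ o, ψ o ∂P = 0
  pathwise : ∀ s : 𝒪 → ℝ, MemLp s 2 P → ∫ o, s o ∂P = 0 →
    HasDerivWithinAt (fun t => θ (perturb P s t)) (∫ o, ψ o * s o ∂P) (validTimes P s) 0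

/-- `ψ` is the efficient influence function of `θ` at `P`: the influence function, unique up to
`P`-null sets. -/
structure IsEfficientInfluenceFunction (θ : Measure 𝒪 → ℝ) (P : Measure 𝒪) (ψ : 𝒪 → ℝ) :
    Prop where
  influence : IsInfluenceFunction θ P ψ
  unique : ∀ φ : 𝒪 → ℝ, IsInfluenceFunction θ P φ → φ =ᵐ[P] ψ

end Semiparametric

/-- The `p`-quantile of a probability law on the line. -/
def quantile (ν : Measure ℝ) (p : ℝ) : ℝ := sInf {v | p ≤ cdf ν v}

section Experiment

variable {Ω 𝒳 : Type*} [MeasurableSpace Ω] [MeasurableSpace 𝒳]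

/-- `e_D(X) = P(D = 1 | X)`. -/
def treatmentProb (μ : Measure Ω) (X : Ω → 𝒳) (D : Ω → Bool) : Ω → ℝ :=
  condExp (MeasurableSpace.comap X inferInstance) μ ({ω | D ω = true}.indicator fun _ => (1 : ℝ))

/-- `P(R = r | X, D)`. For `r = 1` this is `e_R(X, D)`. -/
def responseProb (μ : Measure Ω) (X : Ω → 𝒳) (D R : Ω → Bool) (r : Bool) : Ω → ℝ :=
  condExp (MeasurableSpace.comap (fun ω => (X ω, D ω)) inferInstance) μ
    ({ω | R ω = r}.indicator fun _ => (1 : ℝ))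

/-- Missing at random: `(Y(1), Y(0))` and `R` are conditionally independent given `(X, D)`. -/
def MissingAtRandom [StandardBorelSpace Ω] (μ : Measure Ω) [IsFiniteMeasure μ]
    {X : Ω → 𝒳} {D : Ω → Bool} (hX : Measurable X) (hD : Measurable D)
    (R : Ω → Bool) (Y : Bool → Ω → ℝ) : Prop :=
  CondIndepFun (MeasurableSpace.comap (fun ω => (X ω, D ω)) inferInstance)
    (hX.prodMk hD).comap_le (fun ω => (Y true ω, Y false ω)) R μ

/-- Overlap for the treatment and for the response. -/
def Overlap (μ : Measure Ω) (X : Ω → 𝒳) (D R : Ω → Bool) : Prop :=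
  ∃ c : ℝ, 0 < c ∧ ∀ᵐ ω ∂μ,
    (c < treatmentProb μ X D ω ∧ treatmentProb μ X D ω < 1 - c) ∧
    (c < responseProb μ X D R true ω ∧ responseProb μ X D R true ω < 1 - c)

/-- The endpoints of the interval `C_ITE(x; d, y)` for the individual treatment effect built from
prediction intervals `C_d(x) = [lo d x, hi d x]` for the potential outcomes: it is `y - C_0(x)` for a
treated and `C_1(x) - y` for a control unit with outcome `y`. -/
def iteInterval (lo hi : Bool → 𝒳 → ℝ) (x : 𝒳) (d : Bool) (y : ℝ) : ℝ × ℝ :=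
  if d = true then (y - hi false x, y - lo false x) else (lo true x - y, hi true x - y)

/-- The interval nonconformity score `V_C = V(x, C_ITE(x; d, y))`. -/
def intervalScore (V : 𝒳 × (ℝ × ℝ) → ℝ) (lo hi : Bool → 𝒳 → ℝ) (x : 𝒳) (d : Bool) (y : ℝ) : ℝ :=
  V (x, iteInterval lo hi x d y)

/-- The law of `V_C = V(X, C_ITE(X; D, Y^obs))`, `Y^obs = Y(D)`, given `R = 0`, where `v x d y` is the
score as a function of covariates, treatment and outcome. -/
def attritionLaw (μ : Measure Ω) (X : Ω → 𝒳) (D R : Ω → Bool) (Y : Bool → Ω → ℝ)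
    (v : 𝒳 → Bool → ℝ → ℝ) : Measure ℝ :=
  (cond μ {ω | R ω = false}).map fun ω => v (X ω) (D ω) (Y (D ω) ω)

/-- Values of the observed data `(x, d, r, y)`; the outcome `y` is set to `0` if `r = 0`. -/
abbrev Obs (𝒳 : Type*) := 𝒳 × Bool × Bool × ℝ

/-- The observed data `(X, D, R, R Y^obs)`. -/
def observe (X : Ω → 𝒳) (D R : Ω → Bool) (Y : Bool → Ω → ℝ) (ω : Ω) : Obs 𝒳 :=
  (X ω, D ω, R ω, if R ω = true then Y (D ω) ω else 0)

end Experiment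

section ObservedData

variable {𝒳 : Type*} [MeasurableSpace 𝒳]

namespace Obs

def x (o : Obs 𝒳) : 𝒳 := o.1
def d (o : Obs 𝒳) : Bool := o.2.1
def r (o : Obs 𝒳) : Bool := o.2.2.1
def y (o : Obs 𝒳) : ℝ := o.2.2.2

end Obs

/-- `m_C(η, X, D) = E_P[1{V_C < η} | X, D, R = 1]`, as a `σ(X, D)`-measurable function of the observed
data. -/
def mC (v : 𝒳 → Bool → ℝ → ℝ) (P : Measure (Obs 𝒳)) (η : ℝ) : Obs 𝒳 → ℝ :=
  condExp (MeasurableSpace.comap (fun o : Obs 𝒳 => (Obs.x o, Obs.d o)) inferInstance)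
    (cond P {o | Obs.r o = true})
    ({o | v (Obs.x o) (Obs.d o) (Obs.y o) < η}.indicator fun _ => (1 : ℝ))

/-- The response odds `π_R(X, D) = P(R = 1 | X, D) / P(R = 0 | X, D)` under the observed law. -/
def piR (P : Measure (Obs 𝒳)) (o : Obs 𝒳) : ℝ :=
  responseProb P Obs.x Obs.d Obs.r true o / responseProb P Obs.x Obs.d Obs.r false o

/-- The parameter as a functional of the observed-data law: the smallest `η` (as an infimum) with
`E_P[m_C(η, X, D) | R = 0] ≥ p`, i.e. the solution of the moment condition
`E_P[(1 - R) (m_C(η, X, D) - p)] = 0` in the sense of the generalized inverse. -/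
def etaC (v : 𝒳 → Bool → ℝ → ℝ) (p : ℝ) (P : Measure (Obs 𝒳)) : ℝ :=
  sInf {η | p ≤ ∫ o, mC v P η o ∂(cond P {o | Obs.r o = false})}

/-- `ψ_C = (1 - R) [m_C(η, X, D) - (1 - γ)] + R / π_R(X, D) [1{V_C < η} - m_C(η, X, D)]`. -/
def psiC (v : 𝒳 → Bool → ℝ → ℝ) (P : Measure (Obs 𝒳)) (γ η : ℝ) (o : Obs 𝒳) : ℝ :=
  let r : ℝ := if Obs.r o = true then 1 else 0
  (1 - r) * (mC v P η o - (1 - γ)) +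
    r / piR P o *
      ((if v (Obs.x o) (Obs.d o) (Obs.y o) < η then 1 else 0) - mC v P η o)

end ObservedData

end Attrition

end

/-! Write `A` for the event of response, `p = 1 - γ`, `P_t = (1 + t s) P`, and `n_t(v)` for the
conditional probability of `{V_C < v}` given `(X, D)` and `A` under `P_t`.

Identification: by missingness at random the score has the same conditional law given `(X, D)` among
respondents and nonrespondents, so averaging `n_0(v)` over `Aᶜ` gives the left-continuous
distribution function of the score given `R = 0` (`integral_mC_eq_attritionLaw`). Left- and
right-continuous versions have the same quantiles, and the same derivative at a point where one of
them is differentiable (`quantile_eq_sInf_Iio`, `hasDerivAt_of_leftLim`).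

Derivative: `η(P_t)` is the generalized inverse at `0` of the monotone function `G_t(v) =
E_{P_t}[1_{Aᶜ} (n_t(v) - p)]`. With `ρ` the odds of nonresponse and `B = G_0`, the augmented
gradient `1_{Aᶜ} (n_0 - p) + 1_A ρ (1_{V_C < v} - n_0)` makes the effect of replacing `n_0` by `n_t`
second order: `G_t(v) = B(v) + t a(v) + O(t²)` uniformly in `v`, where `a(v)` is the integral of `s`
against the gradient (`abs_moment_sub_le`). The gradients move continuously in `L²` with modulus
governed by `B` (`integral_momentGradient_sub_sq_le`), so `a` is continuous at `η`. Since `B` has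
slope `b = P(Aᶜ) f > 0` at `η`, the sign of `G_t` at `η - t a(η)/b ± ε|t|` is determined for small
`t`, and monotonicity traps `η(P_t)` between these points (`hasDerivWithinAt_sInf`). The derivative
is therefore `-a(η)/b`, which yields `ψ_C` with constant `-1/b`.

Uniqueness: the centred indicators are bounded scores, and they already determine an influence
function almost everywhere (`IsInfluenceFunction.ae_eq`). -/

noncomputable section

namespace Attrition

/-! ### Bounded versions of conditional probabilities and odds under overlap. -/

section Versions

variable {𝒪 : Type*}

/-- The real-valued indicator of a set. -/
abbrev ind (A : Set 𝒪) : 𝒪 → ℝ := A.indicator fun _ => (1 : ℝ)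

lemma ind_nonneg (A : Set 𝒪) (o : 𝒪) : 0 ≤ ind A o := by
  by_cases h : o ∈ A <;> simp [ind, h]

lemma ind_le_one (A : Set 𝒪) (o : 𝒪) : ind A o ≤ 1 := by
  by_cases h : o ∈ A <;> simp [ind, h]

lemma ind_compl (A : Set 𝒪) (o : 𝒪) : ind Aᶜ o = 1 - ind A o := by
  by_cases h : o ∈ A <;> simp [ind, h]

lemma ind_mono {A B : Set 𝒪} (h : A ⊆ B) (o : 𝒪) : ind A o ≤ ind B o :=
  indicator_le_indicator_of_subset (f := fun _ => (1 : ℝ)) h (fun _ => zero_le_one) o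

lemma ind_mul_eq_indicator (A : Set 𝒪) (f : 𝒪 → ℝ) :
    (fun o => ind A o * f o) = A.indicator f := by
  ext o
  by_cases h : o ∈ A <;> simp [ind, h]

/-- Bounded functions that are measurable with respect to `m`. -/
structure BddMeas (m : MeasurableSpace 𝒪) (f : 𝒪 → ℝ) : Prop where
  meas : StronglyMeasurable[m] f
  bdd : ∃ C, ∀ o, |f o| ≤ C

namespace BddMeas

variable {m m' : MeasurableSpace 𝒪} {f g : 𝒪 → ℝ}

lemma mono (hf : BddMeas m f) (h : m ≤ m') : BddMeas m' f := ⟨hf.meas.mono h, hf.bdd⟩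

lemma const (c : ℝ) : BddMeas m (fun _ => c) := ⟨stronglyMeasurable_const, |c|, fun _ => le_rfl⟩

lemma ind {A : Set 𝒪} (hA : MeasurableSet[m] A) : BddMeas m (ind A) :=
  ⟨stronglyMeasurable_const.indicator hA, 1, fun o => by
    rw [abs_of_nonneg (ind_nonneg A o)]; exact ind_le_one A o⟩

lemma add (hf : BddMeas m f) (hg : BddMeas m g) : BddMeas m (fun o => f o + g o) := by
  obtain ⟨C, hC⟩ := hf.bdd
  obtain ⟨K, hK⟩ := hg.bdd
  exact ⟨hf.meas.add hg.meas, C + K, fun o => (abs_add_le _ _).trans (add_le_add (hC o) (hK o))⟩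

lemma neg (hf : BddMeas m f) : BddMeas m (fun o => - f o) := by
  obtain ⟨C, hC⟩ := hf.bdd
  exact ⟨hf.meas.neg, C, fun o => by rw [abs_neg]; exact hC o⟩

lemma sub (hf : BddMeas m f) (hg : BddMeas m g) : BddMeas m (fun o => f o - g o) := by
  simpa only [sub_eq_add_neg] using hf.add hg.neg

lemma mul (hf : BddMeas m f) (hg : BddMeas m g) : BddMeas m (fun o => f o * g o) := by
  obtain ⟨C, hC⟩ := hf.bdd
  obtain ⟨K, hK⟩ := hg.bdd
  refine ⟨hf.meas.mul hg.meas, C * K, fun o => ?_⟩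
  rw [abs_mul]
  exact mul_le_mul (hC o) (hK o) (abs_nonneg _) ((abs_nonneg _).trans (hC o))

lemma abs (hf : BddMeas m f) : BddMeas m (fun o => |f o|) := by
  obtain ⟨C, hC⟩ := hf.bdd
  exact ⟨hf.meas.norm, C, fun o => by rw [abs_abs]; exact hC o⟩

lemma integrable_mul {P : Measure[m] 𝒪} (hf : BddMeas m f) {s : 𝒪 → ℝ}
    (hs : Integrable s P) : Integrable (fun o => s o * f o) P := by
  obtain ⟨C, hC⟩ := hf.bdd
  simpa only [mul_comm] using
    hs.bdd_mul (c := C) hf.meas.aestronglyMeasurable (Filter.Eventually.of_forall hC)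

lemma integrable {P : Measure[m] 𝒪} [IsFiniteMeasure P] (hf : BddMeas m f) : Integrable f P := by
  simpa using hf.integrable_mul (integrable_const (1 : ℝ))

lemma memLp_two {P : Measure[m] 𝒪} [IsFiniteMeasure P] (hf : BddMeas m f) : MemLp f 2 P := by
  obtain ⟨C, hC⟩ := hf.bdd
  exact MemLp.of_bound hf.meas.aestronglyMeasurable C (Filter.Eventually.of_forall hC)

lemma max_zero (hf : BddMeas m f) : BddMeas m (fun o => max (f o) 0) := by
  obtain ⟨C, hC⟩ := hf.bdd
  refine ⟨hf.meas.sup stronglyMeasurable_const, C, fun o => ?_⟩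
  rw [abs_of_nonneg (le_max_right _ _)]
  exact max_le ((le_abs_self _).trans (hC o)) ((abs_nonneg _).trans (hC o))

/-- Truncation of a measurable function to an interval. -/
lemma clamp (hf : StronglyMeasurable[m] f) (a b : ℝ) :
    BddMeas m (fun o => max a (min b (f o))) := by
  refine ⟨stronglyMeasurable_const.sup (stronglyMeasurable_const.inf hf), |a| + |b|, fun o => ?_⟩
  have h1 : max a (min b (f o)) ≤ |a| + |b| :=
    max_le (by linarith [le_abs_self a, abs_nonneg b])
      ((min_le_left _ _).trans (by linarith [le_abs_self b, abs_nonneg a]))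
  have h2 : a ≤ max a (min b (f o)) := le_max_left _ _
  exact abs_le.2 ⟨by linarith [neg_abs_le a, abs_nonneg b], h1⟩

end BddMeas

variable {m mO : MeasurableSpace 𝒪}

lemma integral_cond_eq (Q : Measure 𝒪) {A : Set 𝒪} (hA : MeasurableSet A)
    (f : 𝒪 → ℝ) :
    ∫ o, f o ∂(cond Q A) = (Q.real A)⁻¹ * ∫ o, ind A o * f o ∂Q := by
  rw [ProbabilityTheory.cond, integral_smul_measure, ind_mul_eq_indicator, integral_indicator hA,
    ENNReal.toReal_inv]
  rfl

/-- Defining property of a conditional expectation, tested against bounded functions. -/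
lemma integral_mul_condExp (hm : m ≤ mO) (Q : Measure 𝒪) [IsFiniteMeasure Q] {h k : 𝒪 → ℝ}
    (hh : BddMeas m h) (hk : Integrable k Q) :
    ∫ o, h o * k o ∂Q = ∫ o, h o * (condExp m Q k) o ∂Q := by
  obtain ⟨C, hC⟩ := hh.bdd
  have := condExp_stronglyMeasurable_mul_of_bound hm hh.meas hk C (Filter.Eventually.of_forall hC)
  rw [← integral_condExp hm (f := fun o => h o * k o)]
  exact integral_congr_ae this

/-- The conditional probability of `S` given `m` and `A`, truncated to `[0, 1]`. -/
lemma exists_version (hm : m ≤ mO) (Q : Measure 𝒪) [IsFiniteMeasure Q] {A S : Set 𝒪}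
    (hA : MeasurableSet A) (hQA : Q A ≠ 0) (hS : MeasurableSet S) :
    ∃ n : 𝒪 → ℝ, BddMeas m n ∧ (∀ o, 0 ≤ n o ∧ n o ≤ 1) ∧
      n =ᵐ[cond Q A] condExp m (cond Q A) (ind S) ∧
      ∀ h, BddMeas m h →
        ∫ o, ind A o * (h o * ind S o) ∂Q = ∫ o, ind A o * (h o * n o) ∂Q := by
  have hprob : IsProbabilityMeasure (cond Q A) := cond_isProbabilityMeasure hQA
  have hint : Integrable (ind S) (cond Q A) := (BddMeas.ind hS).integrable
  set e := condExp m (cond Q A) (ind S) with he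
  have h0 : 0 ≤ᵐ[cond Q A] e := condExp_nonneg (Filter.Eventually.of_forall (ind_nonneg S))
  have h1 : e ≤ᵐ[cond Q A] fun _ => (1 : ℝ) := by
    have := condExp_mono (m := m) hint (integrable_const (μ := cond Q A) (1 : ℝ))
      (Filter.Eventually.of_forall (ind_le_one S))
    rwa [condExp_const hm] at this
  have hne : (fun o => max 0 (min 1 (e o))) =ᵐ[cond Q A] e := by
    filter_upwards [h0, h1] with o h0 h1
    rw [min_eq_right h1, max_eq_right (a := (0 : ℝ)) h0]
  -- Truncation changes `e` only on a null set, and turns its almost sure bounds into bounds at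
  -- every point, so that the version can itself serve as a test function.
  refine ⟨fun o => max 0 (min 1 (e o)), BddMeas.clamp stronglyMeasurable_condExp 0 1,
    fun o => ⟨le_max_left _ _, max_le zero_le_one (min_le_left _ _)⟩, hne, fun h hh => ?_⟩
  have key := integral_mul_condExp hm (cond Q A) hh hint
  have key2 : ∫ o, h o * e o ∂(cond Q A) = ∫ o, h o * max 0 (min 1 (e o)) ∂(cond Q A) :=
    integral_congr_ae (by filter_upwards [hne] with o ho; rw [ho])
  rw [key2, integral_cond_eq Q hA, integral_cond_eq Q hA] at key
  refine mul_left_cancel₀ (inv_ne_zero ?_) key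
  exact (ENNReal.toReal_pos hQA (measure_ne_top Q A)).ne'

variable {P : Measure 𝒪} [IsProbabilityMeasure P] {A : Set 𝒪} {c : ℝ}

/-- The conditional probability of `A` given `m` is bounded away from `0` and `1`. -/
structure StrictOverlap (m : MeasurableSpace 𝒪) {mO : MeasurableSpace 𝒪} (P : Measure 𝒪)
    (A : Set 𝒪) (c : ℝ) : Prop where
  pos : 0 < c
  bounds : ∀ᵐ o ∂P, c < condExp m P (ind A) o ∧ condExp m P (ind A) o < 1 - c

namespace StrictOverlap

/-- Conditioning on `m` replaces the indicator of `A` by a factor of at least `c`. This is the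
coercivity behind all later estimates: `m`-measurable quantities are controlled by their part on
`A`. -/
lemma le_integral (hm : m ≤ mO) (H : StrictOverlap m P A c) (hA : MeasurableSet A) {h : 𝒪 → ℝ}
    (hh : BddMeas m h) (h0 : ∀ᵐ o ∂P, 0 ≤ h o) :
    c * ∫ o, h o ∂P ≤ ∫ o, ind A o * h o ∂P := by
  simp_rw [mul_comm (ind A _)]
  rw [integral_mul_condExp hm P hh (BddMeas.ind hA).integrable, ← integral_const_mul]
  refine integral_mono_ae ((hh.mono hm).integrable.const_mul c) ?_ ?_
  · simpa only [mul_comm] using (hh.mono hm).integrable_mul (integrable_condExp (f := ind A))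
  · filter_upwards [H.bounds, h0] with o ho h0
    nlinarith [ho.1]

lemma condExp_compl (hm : m ≤ mO) (hA : MeasurableSet A) :
    condExp m P (ind Aᶜ) =ᵐ[P] fun o => 1 - condExp m P (ind A) o := by
  have : ind Aᶜ = (fun _ => (1 : ℝ)) - ind A := by ext o; exact ind_compl A o
  rw [this]
  have h := condExp_sub (m := m) (integrable_const (μ := P) (1 : ℝ))
    ((BddMeas.ind hA).integrable (P := P))
  rw [condExp_const hm] at h
  exact h

lemma compl (hm : m ≤ mO) (H : StrictOverlap m P A c) (hA : MeasurableSet A) :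
    StrictOverlap m P Aᶜ c := by
  refine ⟨H.pos, ?_⟩
  filter_upwards [H.bounds, condExp_compl hm hA] with o ho he
  rw [he]
  constructor <;> linarith [ho.1, ho.2]

lemma measure_pos (hm : m ≤ mO) (H : StrictOverlap m P A c) (hA : MeasurableSet A) :
    0 < P.real A := by
  have := H.le_integral hm hA (BddMeas.const 1) (Filter.Eventually.of_forall fun _ => zero_le_one)
  have h2 : ∫ o, ind A o * 1 ∂P = P.real A := by
    simp only [mul_one]; exact integral_indicator_one hA
  rw [h2] at this
  simp at this
  linarith [H.pos]

/-- The disagreement set is `m`-measurable, so by overlap it cannot be null on `A` without being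
null. This gives meaning off `A` to conditional expectations given `A`, which are then integrated
over `Aᶜ`. -/
lemma ae_eq_of_restrict (hm : m ≤ mO) (H : StrictOverlap m P A c) (hA : MeasurableSet A)
    {f g : 𝒪 → ℝ} (hf : StronglyMeasurable[m] f) (hg : StronglyMeasurable[m] g)
    (h : f =ᵐ[P.restrict A] g) : f =ᵐ[P] g := by
  have hB : MeasurableSet[m] {o | f o = g o}ᶜ :=
    (hf.measurableSet_eq_fun hg).compl
  have h1 := H.le_integral hm hA (BddMeas.ind hB)
    (Filter.Eventually.of_forall fun o => ind_nonneg _ o)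
  have h2 : ∫ o, ind A o * ind {o | f o = g o}ᶜ o ∂P = 0 := by
    rw [ind_mul_eq_indicator, integral_indicator hA]
    refine integral_eq_zero_of_ae ?_
    filter_upwards [h] with o ho
    simp [ind, ho]
  have h3 : ∫ o, ind {o | f o = g o}ᶜ o ∂P = P.real {o | f o = g o}ᶜ :=
    integral_indicator_one (hm _ hB)
  rw [h2, h3] at h1
  have h4 : P.real {o | f o = g o}ᶜ = 0 :=
    le_antisymm (by nlinarith [H.pos]) measureReal_nonneg
  exact (measureReal_eq_zero_iff).1 h4

/-- The conditional odds of `Aᶜ`, as a bounded weight that transports integrals over `A` to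
integrals over `Aᶜ`. -/
lemma exists_odds (hm : m ≤ mO) (H : StrictOverlap m P A c) (hA : MeasurableSet A) :
    ∃ ρ : 𝒪 → ℝ, BddMeas m ρ ∧ (∀ o, 0 ≤ ρ o ∧ ρ o ≤ 1 / c) ∧
      (ρ =ᵐ[P] fun o => condExp m P (ind Aᶜ) o / condExp m P (ind A) o) ∧
      ∀ h, BddMeas m h → ∫ o, ind Aᶜ o * h o ∂P = ∫ o, ind A o * (ρ o * h o) ∂P := by
  set e1 := condExp m P (ind A)
  set e0 := condExp m P (ind Aᶜ)
  have hc := H.pos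
  have hcl : BddMeas m (fun o => max 0 (min (1 / c) (e0 o / e1 o))) :=
    BddMeas.clamp (StronglyMeasurable.div stronglyMeasurable_condExp
      stronglyMeasurable_condExp) 0 (1 / c)
  have heq : (fun o => max 0 (min (1 / c) (e0 o / e1 o))) =ᵐ[P] fun o => e0 o / e1 o := by
    filter_upwards [H.bounds, condExp_compl hm hA] with o ho he
    have h1 : e0 o / e1 o ≤ 1 / c := by
      have he0 : e0 o ≤ 1 := by change e0 o = _ at he; linarith [ho.1]
      exact div_le_div₀ zero_le_one he0 hc ho.1.le
    have h0 : 0 ≤ e0 o / e1 o :=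
      div_nonneg (by change e0 o = _ at he; linarith [ho.2]) (hc.trans ho.1).le
    rw [min_eq_right h1, max_eq_right h0]
  refine ⟨_, hcl, fun o => ⟨le_max_left _ _, max_le (by positivity) (min_le_left _ _)⟩, heq,
    fun h hh => ?_⟩
  simp_rw [mul_comm (ind _ _)]
  rw [integral_mul_condExp hm P hh (BddMeas.ind hA.compl).integrable,
    integral_mul_condExp hm P (hcl.mul hh) (BddMeas.ind hA).integrable]
  refine integral_congr_ae ?_
  filter_upwards [heq, H.bounds] with o ho hb
  change h o * e0 o = _ * h o * e1 o
  rw [ho]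
  have : e1 o ≠ 0 := (hc.trans hb.1).ne'
  field_simp

end StrictOverlap

/-- Conditional probabilities under `g P`, for a density `g` bounded away from zero, in terms
of `P`. -/
lemma exists_version_withDensity (hm : m ≤ mO) (H : StrictOverlap m P A c) (hA : MeasurableSet A)
    {S : Set 𝒪} (hS : MeasurableSet S) {g : 𝒪 → ℝ} (hg : Integrable g P) {ε : ℝ} (hε : 0 < ε)
    (hgε : ∀ᵐ o ∂P, ε ≤ g o) :
    ∃ n : 𝒪 → ℝ, BddMeas m n ∧ (∀ o, 0 ≤ n o ∧ n o ≤ 1) ∧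
      n =ᵐ[P] condExp m (cond (P.withDensity fun o => ENNReal.ofReal (g o)) A) (ind S) ∧
      ∀ h, BddMeas m h →
        ∫ o, g o * (ind A o * (h o * ind S o)) ∂P = ∫ o, g o * (ind A o * (h o * n o)) ∂P := by
  set Q := P.withDensity fun o => ENNReal.ofReal (g o) with hQ
  have : IsFiniteMeasure Q := isFiniteMeasure_withDensity_ofReal hg.2
  have hgm : AEMeasurable (fun o => ENNReal.ofReal (g o)) P := hg.1.aemeasurable.ennreal_ofReal
  have hPQ : P ≪ Q := withDensity_absolutelyContinuous' hgm (by
    filter_upwards [hgε] with o ho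
    simpa using hε.trans_le ho)
  have hPA : P A ≠ 0 := fun h => by
    have := H.measure_pos hm hA
    simp [measureReal_def, h] at this
  have hQA : Q A ≠ 0 := fun h => hPA (hPQ h)
  obtain ⟨n, hn, hn01, hneq, hnint⟩ := exists_version hm Q hA hQA hS
  refine ⟨n, hn, hn01, ?_, fun h hh => ?_⟩
  -- The two versions are known to agree only under the law conditioned on `A`; overlap extends this
  -- to all of `P`.
  · refine H.ae_eq_of_restrict hm hA hn.meas stronglyMeasurable_condExp ?_
    have h1 : P.restrict A ≪ cond Q A := by
      rw [ProbabilityTheory.cond]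
      refine (hPQ.restrict A).trans ?_
      exact Measure.absolutelyContinuous_smul (by simp [measure_ne_top])
    exact h1.ae_le hneq
  · have h1 := hnint h hh
    have hconv : ∀ k : 𝒪 → ℝ, ∫ o, k o ∂Q = ∫ o, g o * k o ∂P := fun k => by
      rw [hQ, integral_withDensity_eq_integral_toReal_smul₀ hgm (by simp)]
      refine integral_congr_ae ?_
      filter_upwards [hgε] with o ho
      rw [ENNReal.toReal_ofReal (hε.le.trans ho), smul_eq_mul]
    rwa [hconv, hconv] at h1

end Versions

/-! ### First-order expansion of the missing-data moment. -/

section Expansion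

variable {𝒪 : Type*} {m mO : MeasurableSpace 𝒪} {P : Measure 𝒪}
  {A S S' : Set 𝒪} {c : ℝ} {s g n n' ρ : 𝒪 → ℝ} {p t : ℝ}

/-- `n` is a version with values in `[0, 1]` of the conditional probability of `S` given `m` and
`A` under `g P`. -/
structure IsCondProb (m : MeasurableSpace 𝒪) {mO : MeasurableSpace 𝒪} (P : Measure 𝒪)
    (g : 𝒪 → ℝ) (A S : Set 𝒪) (n : 𝒪 → ℝ) : Prop where
  bddMeas : BddMeas m n
  nonneg : ∀ o, 0 ≤ n o
  le_one : ∀ o, n o ≤ 1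
  integral_eq : ∀ h, BddMeas m h →
    ∫ o, g o * (ind A o * (h o * ind S o)) ∂P = ∫ o, g o * (ind A o * (h o * n o)) ∂P

/-- `ρ` is a version with values in `[0, 1 / c]` of the conditional odds of `Aᶜ` given `m`. -/
structure IsOdds (m : MeasurableSpace 𝒪) {mO : MeasurableSpace 𝒪} (P : Measure 𝒪)
    (A : Set 𝒪) (c : ℝ) (ρ : 𝒪 → ℝ) : Prop where
  bddMeas : BddMeas m ρ
  nonneg : ∀ o, 0 ≤ ρ o
  le : ∀ o, ρ o ≤ 1 / c
  integral_eq : ∀ h, BddMeas m h → ∫ o, ind Aᶜ o * h o ∂P = ∫ o, ind A o * (ρ o * h o) ∂P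

/-- The uncentred gradient of the missing-data moment `E[1_{Aᶜ} (n - p)]`. -/
def momentGradient (A S : Set 𝒪) (ρ n : 𝒪 → ℝ) (p : ℝ) (o : 𝒪) : ℝ :=
  ind Aᶜ o * (n o - p) + ind A o * (ρ o * (ind S o - n o))

lemma bddMeas_momentGradient (hm : m ≤ mO) (hA : MeasurableSet A) (hS : MeasurableSet S)
    (hρ : BddMeas m ρ) (hn : BddMeas m n) (p : ℝ) :
    BddMeas mO (momentGradient A S ρ n p) :=
  ((BddMeas.ind hA.compl).mul ((hn.mono hm).sub (BddMeas.const p))).add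
    ((BddMeas.ind hA).mul ((hρ.mono hm).mul ((BddMeas.ind hS).sub (hn.mono hm))))

/-- The residual is orthogonal to `m`-measurable functions on `A`: the normal equations of the
conditional probability, which allow the augmentation term to be inserted or removed freely. -/
lemma IsCondProb.integral_residual (hm : m ≤ mO) (hA : MeasurableSet A) (hS : MeasurableSet S)
    (hn : IsCondProb m P g A S n) (hg : Integrable g P) {h : 𝒪 → ℝ} (hh : BddMeas m h) :
    ∫ o, g o * (ind A o * (h o * (ind S o - n o))) ∂P = 0 := by
  have h1 : Integrable (fun o => g o * (ind A o * (h o * ind S o))) P :=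
    ((BddMeas.ind hA).mul ((hh.mono hm).mul (BddMeas.ind hS))).integrable_mul hg
  have h2 : Integrable (fun o => g o * (ind A o * (h o * n o))) P :=
    ((BddMeas.ind hA).mul ((hh.mono hm).mul (hn.bddMeas.mono hm))).integrable_mul hg
  have := integral_sub h1 h2
  rw [hn.integral_eq h hh, sub_self] at this
  rw [← this]
  exact integral_congr_ae (Filter.Eventually.of_forall fun o => by ring)

variable [IsProbabilityMeasure P]

lemma integral_one_add_mul (hs : Integrable s P) {k : 𝒪 → ℝ} (hk : BddMeas mO k) (t : ℝ) :
    ∫ o, (1 + t * s o) * k o ∂P = ∫ o, k o ∂P + t * ∫ o, s o * k o ∂P := by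
  rw [← integral_const_mul, ← integral_add hk.integrable ((hk.integrable_mul hs).const_mul t)]
  exact integral_congr_ae (Filter.Eventually.of_forall fun o => by ring)

lemma IsCondProb.integral_residual_one (hm : m ≤ mO) (hA : MeasurableSet A)
    (hS : MeasurableSet S) (hn : IsCondProb m P (fun _ => 1) A S n) {h : 𝒪 → ℝ}
    (hh : BddMeas m h) : ∫ o, ind A o * (h o * (ind S o - n o)) ∂P = 0 := by
  simpa using hn.integral_residual hm hA hS (integrable_const (1 : ℝ)) hh

lemma integral_momentGradient (hm : m ≤ mO) (hA : MeasurableSet A) (hS : MeasurableSet S)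
    (hρ : BddMeas m ρ) (hn : IsCondProb m P (fun _ => 1) A S n) :
    ∫ o, momentGradient A S ρ n p o ∂P = ∫ o, ind Aᶜ o * (n o - p) ∂P := by
  have h1 := hn.integral_residual_one hm hA hS hρ
  have h2 : Integrable (fun o => ind Aᶜ o * (n o - p)) P :=
    ((BddMeas.ind hA.compl).mul ((hn.bddMeas.mono hm).sub (BddMeas.const p))).integrable
  have h3 : Integrable (fun o => ind A o * (ρ o * (ind S o - n o))) P :=
    ((BddMeas.ind hA).mul ((hρ.mono hm).mul
      ((BddMeas.ind hS).sub (hn.bddMeas.mono hm)))).integrable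
  have := integral_add h2 h3
  rw [h1, add_zero] at this
  exact this

/-- Conditional probabilities depend on the path `(1 + t s) P` in a Lipschitz way. -/
lemma integral_abs_mul_sub_le (hm : m ≤ mO) (H : StrictOverlap m P A c) (hA : MeasurableSet A)
    (hS : MeasurableSet S) (hs : MemLp s 2 P)
    (hg : ∀ᵐ o ∂P, 1 / 2 ≤ 1 + t * s o)
    (hn : IsCondProb m P (fun _ => 1) A S n)
    (hn' : IsCondProb m P (fun o => 1 + t * s o) A S n') :
    |t| * ∫ o, |s o| * |n' o - n o| ∂P ≤ 2 / c * t ^ 2 * ∫ o, s o ^ 2 ∂P := by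
  have hc := H.pos
  have hsI : Integrable s P := hs.integrable (by norm_num)
  have hgI : Integrable (fun o => 1 + t * s o) P := (integrable_const _).add (hsI.const_mul t)
  have hs2 : Integrable (fun o => s o ^ 2) P := hs.integrable_sq
  have hδ : BddMeas m (fun o => n' o - n o) := hn'.bddMeas.sub hn.bddMeas
  have hδO := hδ.mono hm
  set E := ∫ o, (n' o - n o) * (n' o - n o) ∂P with hE
  set T := ∫ o, |s o| * |n' o - n o| ∂P with hT
  have hTint : Integrable (fun o => |s o| * |n' o - n o|) P := hδO.abs.integrable_mul hsI.abs
  have b1 : c * E ≤ ∫ o, ind A o * ((n' o - n o) * (n' o - n o)) ∂P :=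
    H.le_integral hm hA (hδ.mul hδ) (Filter.Eventually.of_forall fun o => mul_self_nonneg _)
  have hAδ : BddMeas mO (fun o => ind A o * ((n' o - n o) * (n' o - n o))) :=
    (BddMeas.ind hA).mul (hδO.mul hδO)
  have b2 : 1 / 2 * ∫ o, ind A o * ((n' o - n o) * (n' o - n o)) ∂P ≤
      ∫ o, (1 + t * s o) * (ind A o * ((n' o - n o) * (n' o - n o))) ∂P := by
    rw [← integral_const_mul]
    refine integral_mono_ae (hAδ.integrable.const_mul _) (hAδ.integrable_mul hgI) ?_
    filter_upwards [hg] with o ho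
    exact mul_le_mul_of_nonneg_right ho (mul_nonneg (ind_nonneg A o) (mul_self_nonneg _))
  have hres : BddMeas mO (fun o => ind A o * ((n' o - n o) * (ind S o - n o))) :=
    (BddMeas.ind hA).mul (hδO.mul ((BddMeas.ind hS).sub (hn.bddMeas.mono hm)))
  -- Energy identity: both normal equations are tested against `n' - n`; the one for `n` kills the
  -- term of order zero in `t`.
  have b3 : ∫ o, (1 + t * s o) * (ind A o * ((n' o - n o) * (n' o - n o))) ∂P =
      t * ∫ o, s o * (ind A o * ((n' o - n o) * (ind S o - n o))) ∂P := by
    have e1 := hn'.integral_residual hm hA hS hgI hδ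
    have e2 := integral_one_add_mul hsI hres t
    rw [hn.integral_residual_one hm hA hS hδ, zero_add] at e2
    rw [← e2, ← sub_zero (∫ o, (1 + t * s o) * (ind A o * ((n' o - n o) * (ind S o - n o))) ∂P),
      ← e1, ← integral_sub (hres.integrable_mul hgI)]
    · exact integral_congr_ae (Filter.Eventually.of_forall fun o => by ring)
    · exact ((BddMeas.ind hA).mul (hδO.mul ((BddMeas.ind hS).sub
        (hn'.bddMeas.mono hm)))).integrable_mul hgI
  have b4 : |∫ o, s o * (ind A o * ((n' o - n o) * (ind S o - n o))) ∂P| ≤ T := by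
    refine (abs_integral_le_integral_abs).trans ?_
    refine integral_mono ((hres.integrable_mul hsI).abs) hTint fun o => ?_
    have h1 : |ind A o| ≤ 1 := by
      rw [abs_of_nonneg (ind_nonneg A o)]; exact ind_le_one A o
    have h2 : |ind S o - n o| ≤ 1 := abs_le.2
      ⟨by linarith [ind_nonneg S o, hn.le_one o], by linarith [ind_le_one S o, hn.nonneg o]⟩
    simp only [abs_mul]
    refine mul_le_mul_of_nonneg_left ?_ (abs_nonneg _)
    calc |ind A o| * (|n' o - n o| * |ind S o - n o|)
        ≤ 1 * (|n' o - n o| * 1) := by gcongr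
      _ = |n' o - n o| := by ring
  have b5 : t * ∫ o, s o * (ind A o * ((n' o - n o) * (ind S o - n o))) ∂P ≤ |t| * T :=
    (le_abs_self _).trans (by rw [abs_mul]; exact mul_le_mul_of_nonneg_left b4 (abs_nonneg _))
  -- Young's inequality. Since `b1` to `b5` give `c / 2 * E ≤ |t| * T`, the weight `c / 4` makes the
  -- last term at most half of the left side, so it can be absorbed.
  have b6 : |t| * T ≤ t ^ 2 / c * ∫ o, s o ^ 2 ∂P + c / 4 * E := by
    rw [hT, hE, ← integral_const_mul, ← integral_const_mul, ← integral_const_mul,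
      ← integral_add (hs2.const_mul _) ((hδO.mul hδO).integrable.const_mul _)]
    refine integral_mono (hTint.const_mul _)
      ((hs2.const_mul _).add ((hδO.mul hδO).integrable.const_mul _)) fun o => ?_
    have key := sq_nonneg (|t| * |s o| - c / 2 * |n' o - n o|)
    have e : t ^ 2 / c * s o ^ 2 + c / 4 * ((n' o - n o) * (n' o - n o)) -
        |t| * (|s o| * |n' o - n o|) = (|t| * |s o| - c / 2 * |n' o - n o|) ^ 2 / c := by
      rw [← abs_mul_abs_self (n' o - n o), ← sq_abs t, ← sq_abs (s o)]
      field_simp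
      ring
    have := div_nonneg key hc.le
    rw [← e] at this
    simpa using this
  have b7 : 2 / c * t ^ 2 * ∫ o, s o ^ 2 ∂P = 2 * (t ^ 2 / c * ∫ o, s o ^ 2 ∂P) := by ring
  rw [b7]
  linarith

/-- First-order expansion of the missing-data moment along `(1 + t s) P`, with a remainder that is
uniform in the event `S`. -/
lemma abs_moment_sub_le (hm : m ≤ mO) (H : StrictOverlap m P A c) (hA : MeasurableSet A)
    (hS : MeasurableSet S) (hs : MemLp s 2 P) (hρ : IsOdds m P A c ρ)
    (hg : ∀ᵐ o ∂P, 1 / 2 ≤ 1 + t * s o)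
    (hn : IsCondProb m P (fun _ => 1) A S n)
    (hn' : IsCondProb m P (fun o => 1 + t * s o) A S n') :
    |∫ o, (1 + t * s o) * (ind Aᶜ o * (n' o - p)) ∂P -
      (∫ o, ind Aᶜ o * (n o - p) ∂P + t * ∫ o, s o * momentGradient A S ρ n p o ∂P)| ≤
      (1 + 1 / c) * (2 / c) * (∫ o, s o ^ 2 ∂P) * t ^ 2 := by
  have hc := H.pos
  have hsI : Integrable s P := hs.integrable (by norm_num)
  have hgI : Integrable (fun o => 1 + t * s o) P := (integrable_const _).add (hsI.const_mul t)
  have hδ : BddMeas m (fun o => n' o - n o) := hn'.bddMeas.sub hn.bddMeas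
  have hδO := hδ.mono hm
  have hψ := bddMeas_momentGradient (p := p) hm hA hS hρ.bddMeas hn.bddMeas
  have hβδ : BddMeas mO (fun o => ind Aᶜ o * (n' o - n o)) := (BddMeas.ind hA.compl).mul hδO
  have hαδ : BddMeas mO (fun o => ind A o * (ρ o * (n' o - n o))) :=
    (BddMeas.ind hA).mul ((hρ.bddMeas.mono hm).mul hδO)
  have hκ : BddMeas mO (fun o => ind Aᶜ o * (n' o - n o) - ind A o * (ρ o * (n' o - n o))) :=
    hβδ.sub hαδ
  have hres : BddMeas mO (fun o => ind A o * (ρ o * (ind S o - n' o))) :=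
    (BddMeas.ind hA).mul ((hρ.bddMeas.mono hm).mul ((BddMeas.ind hS).sub (hn'.bddMeas.mono hm)))
  have hsum : Integrable (fun o => (1 + t * s o) * momentGradient A S ρ n p o + (1 + t * s o) *
      (ind Aᶜ o * (n' o - n o) - ind A o * (ρ o * (n' o - n o)))) P :=
    (hψ.integrable_mul hgI).add (hκ.integrable_mul hgI)
  -- Exact decomposition: gradient at `n` plus a term linear in `n' - n`, valid because the residual
  -- of `n'` integrates to zero under the perturbed density.
  have e0 : ∫ o, (1 + t * s o) * (ind Aᶜ o * (n' o - p)) ∂P =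
      ∫ o, (1 + t * s o) * momentGradient A S ρ n p o ∂P +
      ∫ o, (1 + t * s o) *
        (ind Aᶜ o * (n' o - n o) - ind A o * (ρ o * (n' o - n o))) ∂P := by
    rw [← sub_zero (∫ o, (1 + t * s o) * momentGradient A S ρ n p o ∂P + _),
      ← hn'.integral_residual hm hA hS hgI hρ.bddMeas,
      ← integral_add (hψ.integrable_mul hgI) (hκ.integrable_mul hgI),
      ← integral_sub hsum (hres.integrable_mul hgI)]
    refine integral_congr_ae (Filter.Eventually.of_forall fun o => ?_)
    simp only [momentGradient]
    ring
  -- The odds weight balances `A` against `Aᶜ` under `P`, so the linear term only survives against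
  -- `t * s`; as `n' - n` is itself of order `t`, the error is quadratic.
  have e1 : ∫ o, (ind Aᶜ o * (n' o - n o) - ind A o * (ρ o * (n' o - n o))) ∂P = 0 := by
    rw [integral_sub hβδ.integrable hαδ.integrable, hρ.integral_eq _ hδ, sub_self]
  rw [e0, integral_one_add_mul hsI hψ, integral_one_add_mul hsI hκ, e1,
    integral_momentGradient hm hA hS hρ.bddMeas hn, zero_add, add_sub_cancel_left, abs_mul]
  have b4 : |∫ o, s o * (ind Aᶜ o * (n' o - n o) - ind A o * (ρ o * (n' o - n o))) ∂P| ≤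
      (1 + 1 / c) * ∫ o, |s o| * |n' o - n o| ∂P := by
    refine (abs_integral_le_integral_abs).trans ?_
    rw [← integral_const_mul]
    refine integral_mono ((hκ.integrable_mul hsI).abs)
      ((hδO.abs.integrable_mul hsI.abs).const_mul _) fun o => ?_
    have hc1 : (0 : ℝ) ≤ 1 / c := by positivity
    have h2 : |ind Aᶜ o - ind A o * ρ o| ≤ 1 + 1 / c := by
      refine abs_le.2 ⟨?_, ?_⟩
      · have := mul_le_mul (ind_le_one A o) (hρ.le o) (hρ.nonneg o) zero_le_one
        linarith [ind_nonneg Aᶜ o]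
      · linarith [ind_le_one Aᶜ o, mul_nonneg (ind_nonneg A o) (hρ.nonneg o)]
    have e : s o * (ind Aᶜ o * (n' o - n o) - ind A o * (ρ o * (n' o - n o))) =
      (ind Aᶜ o - ind A o * ρ o) * (s o * (n' o - n o)) := by ring
    simp only [e]
    rw [abs_mul, abs_mul]
    gcongr
  calc |t| * |∫ o, s o * (ind Aᶜ o * (n' o - n o) - ind A o * (ρ o * (n' o - n o))) ∂P|
      ≤ |t| * ((1 + 1 / c) * ∫ o, |s o| * |n' o - n o| ∂P) := by gcongr
    _ = (1 + 1 / c) * (|t| * ∫ o, |s o| * |n' o - n o| ∂P) := by ring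
    _ ≤ (1 + 1 / c) * (2 / c * t ^ 2 * ∫ o, s o ^ 2 ∂P) := by
        have := integral_abs_mul_sub_le hm H hA hS hs hg hn hn'
        gcongr
    _ = _ := by ring

/-- Conditional probabilities are monotone in the event. -/
lemma IsCondProb.mono (hm : m ≤ mO) (H : StrictOverlap m P A c) (hA : MeasurableSet A)
    (hS : MeasurableSet S) (hS' : MeasurableSet S') (hSS : S ⊆ S') (hgI : Integrable g P)
    {ε : ℝ} (hε : 0 < ε) (hg : ∀ᵐ o ∂P, ε ≤ g o)
    (hn : IsCondProb m P g A S n) (hn' : IsCondProb m P g A S' n') :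
    n ≤ᵐ[P] n' := by
  have hc := H.pos
  -- The positive part of the violation is the test function: its energy is at most a difference of
  -- integrals that `S ⊆ S'` makes nonpositive.
  set q : 𝒪 → ℝ := fun o => max (n o - n' o) 0 with hq
  have hqm : BddMeas m q := (hn.bddMeas.sub hn'.bddMeas).max_zero
  have hq0 : ∀ o, 0 ≤ q o := fun o => le_max_right _ _
  have hqO := hqm.mono hm
  have hqq : ∀ o, q o * (n o - n' o) = q o * q o := fun o => by
    rcases le_total (n o - n' o) 0 with h | h
    · simp [hq, max_eq_right h]
    · simp [hq, max_eq_left h]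
  have hAq : BddMeas mO (fun o => ind A o * (q o * q o)) := (BddMeas.ind hA).mul (hqO.mul hqO)
  have b1 : c * ∫ o, q o * q o ∂P ≤ ∫ o, ind A o * (q o * q o) ∂P :=
    H.le_integral hm hA (hqm.mul hqm) (Filter.Eventually.of_forall fun o => mul_self_nonneg _)
  have b2 : ε * ∫ o, ind A o * (q o * q o) ∂P ≤ ∫ o, g o * (ind A o * (q o * q o)) ∂P := by
    rw [← integral_const_mul]
    refine integral_mono_ae (hAq.integrable.const_mul _) (hAq.integrable_mul hgI) ?_
    filter_upwards [hg] with o ho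
    exact mul_le_mul_of_nonneg_right ho (mul_nonneg (ind_nonneg A o) (mul_self_nonneg _))
  have i1 : Integrable (fun o => g o * (ind A o * (q o * ind S o))) P :=
    ((BddMeas.ind hA).mul (hqO.mul (BddMeas.ind hS))).integrable_mul hgI
  have i2 : Integrable (fun o => g o * (ind A o * (q o * ind S' o))) P :=
    ((BddMeas.ind hA).mul (hqO.mul (BddMeas.ind hS'))).integrable_mul hgI
  have j1 : Integrable (fun o => g o * (ind A o * (q o * n o))) P :=
    ((BddMeas.ind hA).mul (hqO.mul (hn.bddMeas.mono hm))).integrable_mul hgI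
  have j2 : Integrable (fun o => g o * (ind A o * (q o * n' o))) P :=
    ((BddMeas.ind hA).mul (hqO.mul (hn'.bddMeas.mono hm))).integrable_mul hgI
  have b3 : ∫ o, g o * (ind A o * (q o * q o)) ∂P =
      ∫ o, g o * (ind A o * (q o * ind S o)) ∂P -
        ∫ o, g o * (ind A o * (q o * ind S' o)) ∂P := by
    rw [hn.integral_eq q hqm, hn'.integral_eq q hqm, ← integral_sub j1 j2]
    refine integral_congr_ae (Filter.Eventually.of_forall fun o => ?_)
    simp only [← hqq]
    ring
  have b4 : ∫ o, g o * (ind A o * (q o * ind S o)) ∂P ≤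
      ∫ o, g o * (ind A o * (q o * ind S' o)) ∂P := by
    refine integral_mono_ae i1 i2 ?_
    filter_upwards [hg] with o ho
    refine mul_le_mul_of_nonneg_left ?_ (hε.le.trans ho)
    refine mul_le_mul_of_nonneg_left ?_ (ind_nonneg A o)
    exact mul_le_mul_of_nonneg_left
      (ind_mono hSS o) (hq0 o)
  have b5 : ∫ o, q o * q o ∂P = 0 := by
    refine le_antisymm ?_ (integral_nonneg fun o => mul_self_nonneg _)
    by_contra! h
    have h1 : 0 < c * ∫ o, q o * q o ∂P := mul_pos hc h
    have h2 : 0 < ε * ∫ o, ind A o * (q o * q o) ∂P := mul_pos hε (h1.trans_le b1)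
    linarith
  have b6 := (integral_eq_zero_iff_of_nonneg (fun o => mul_self_nonneg (q o))
    (hqO.mul hqO).integrable).1 b5
  filter_upwards [b6] with o ho
  have : q o = 0 := mul_self_eq_zero.1 ho
  have h2 : n o - n' o ≤ q o := le_max_left _ _
  linarith

/-- The gradients are continuous in mean square, with the missing-data distribution function as
modulus. -/
lemma integral_momentGradient_sub_sq_le (hm : m ≤ mO) (H : StrictOverlap m P A c)
    (hA : MeasurableSet A) (hS : MeasurableSet S) (hS' : MeasurableSet S') (hSS : S ⊆ S')
    (hρ : IsOdds m P A c ρ) (hn : IsCondProb m P (fun _ => 1) A S n)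
    (hn' : IsCondProb m P (fun _ => 1) A S' n') :
    ∫ o, (momentGradient A S' ρ n' p o - momentGradient A S ρ n p o) ^ 2 ∂P ≤
      (1 + 2 / c ^ 2) / c *
        (∫ o, ind Aᶜ o * (n' o - p) ∂P - ∫ o, ind Aᶜ o * (n o - p) ∂P) := by
  have hc := H.pos
  have hmono := IsCondProb.mono hm H hA hS hS' hSS (integrable_const (1 : ℝ)) zero_lt_one
    (Filter.Eventually.of_forall fun _ => le_rfl) hn hn'
  have hd : BddMeas m (fun o => n' o - n o) := hn'.bddMeas.sub hn.bddMeas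
  have hdO := hd.mono hm
  have hD : BddMeas mO (fun o => ind S' o - ind S o) := (BddMeas.ind hS').sub (BddMeas.ind hS)
  have hAd : BddMeas mO (fun o => ind A o * (n' o - n o)) := (BddMeas.ind hA).mul hdO
  have hAD : BddMeas mO (fun o => ind A o * (ind S' o - ind S o)) := (BddMeas.ind hA).mul hD
  have hψ := bddMeas_momentGradient (p := p) hm hA hS hρ.bddMeas hn.bddMeas
  have hψ' := bddMeas_momentGradient (p := p) hm hA hS' hρ.bddMeas hn'.bddMeas
  have e1 : ∫ o, ind A o * (ind S' o - ind S o) ∂P = ∫ o, ind A o * (n' o - n o) ∂P := by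
    have r := hn.integral_residual_one hm hA hS (BddMeas.const 1)
    have r' := hn'.integral_residual_one hm hA hS' (BddMeas.const 1)
    have i : BddMeas mO (fun o => ind A o * (1 * (ind S o - n o))) :=
      (BddMeas.ind hA).mul ((BddMeas.const 1).mul ((BddMeas.ind hS).sub (hn.bddMeas.mono hm)))
    have i' : BddMeas mO (fun o => ind A o * (1 * (ind S' o - n' o))) :=
      (BddMeas.ind hA).mul ((BddMeas.const 1).mul ((BddMeas.ind hS').sub (hn'.bddMeas.mono hm)))
    have h := integral_sub i'.integrable i.integrable (μ := P)
    rw [r, r', sub_zero] at h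
    rw [← sub_eq_zero, ← integral_sub hAD.integrable hAd.integrable, ← h]
    exact integral_congr_ae (Filter.Eventually.of_forall fun o => by ring)
  have e2 : ∫ o, ind A o * (n' o - n o) ∂P ≤ ∫ o, (n' o - n o) ∂P := by
    refine integral_mono_ae hAd.integrable hdO.integrable ?_
    filter_upwards [hmono] with o ho
    nlinarith [ind_le_one A o]
  -- Overlap for `Aᶜ`: the increment of the moment, which lives on `Aᶜ`, controls the increment of
  -- the conditional probability everywhere.
  have e3 : c * ∫ o, (n' o - n o) ∂P ≤ ∫ o, ind Aᶜ o * (n' o - n o) ∂P :=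
    (H.compl hm hA).le_integral hm hA.compl hd (by
      filter_upwards [hmono] with o ho
      linarith)
  have e4 : ∫ o, ind Aᶜ o * (n' o - n o) ∂P =
      ∫ o, ind Aᶜ o * (n' o - p) ∂P - ∫ o, ind Aᶜ o * (n o - p) ∂P := by
    rw [← integral_sub]
    · exact integral_congr_ae (Filter.Eventually.of_forall fun o => by ring)
    · exact ((BddMeas.ind hA.compl).mul
        ((hn'.bddMeas.mono hm).sub (BddMeas.const p))).integrable
    · exact ((BddMeas.ind hA.compl).mul
        ((hn.bddMeas.mono hm).sub (BddMeas.const p))).integrable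
  have e5 : ∫ o, (momentGradient A S' ρ n' p o - momentGradient A S ρ n p o) ^ 2 ∂P ≤
      ∫ o, ((n' o - n o) + 1 / c ^ 2 *
        (ind A o * (ind S' o - ind S o) + ind A o * (n' o - n o))) ∂P := by
    refine integral_mono_ae ?_ ?_ ?_
    · simpa only [sq] using ((hψ'.sub hψ).mul (hψ'.sub hψ)).integrable (P := P)
    · exact (hdO.add ((BddMeas.const _).mul (hAD.add hAd))).integrable
    · filter_upwards [hmono] with o ho
      have hd0 : 0 ≤ n' o - n o := by linarith
      have hd1 : n' o - n o ≤ 1 := by linarith [hn'.le_one o, hn.nonneg o]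
      have hD0 : 0 ≤ ind S' o - ind S o := sub_nonneg.2 (ind_mono hSS o)
      have hD1 : ind S' o - ind S o ≤ 1 := by linarith [ind_le_one S' o, ind_nonneg S o]
      -- On `A` the gradients differ by `ρ` times a difference of two numbers in `[0, 1]`, whose
      -- square is at most their sum; off `A` they differ by `n' - n`, which lies in `[0, 1]`.
      by_cases hoA : o ∈ A
      · have hind : ind A o = 1 := by simp [ind, hoA]
        have e : momentGradient A S' ρ n' p o - momentGradient A S ρ n p o =
            ρ o * ((ind S' o - ind S o) - (n' o - n o)) := by
          simp only [momentGradient, ind_compl, hind]; ring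
        rw [e, hind, mul_pow]
        have h1 : ρ o ^ 2 ≤ 1 / c ^ 2 := by
          have := pow_le_pow_left₀ (hρ.nonneg o) (hρ.le o) 2
          rwa [div_pow, one_pow] at this
        have h2 : ((ind S' o - ind S o) - (n' o - n o)) ^ 2 ≤
            1 * (ind S' o - ind S o) + 1 * (n' o - n o) := by nlinarith
        have h3 := mul_le_mul h1 h2 (sq_nonneg _) (by positivity)
        linarith
      · have hind : ind A o = 0 := by simp [ind, hoA]
        have e : momentGradient A S' ρ n' p o - momentGradient A S ρ n p o = n' o - n o := by
          simp only [momentGradient, ind_compl, hind]; ring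
        rw [e, hind]
        nlinarith
  have e6 : ∫ o, ((n' o - n o) + 1 / c ^ 2 *
        (ind A o * (ind S' o - ind S o) + ind A o * (n' o - n o))) ∂P =
      ∫ o, (n' o - n o) ∂P + 1 / c ^ 2 * (∫ o, ind A o * (n' o - n o) ∂P +
        ∫ o, ind A o * (n' o - n o) ∂P) := by
    rw [integral_add hdO.integrable ((hAD.add hAd).integrable.const_mul _), integral_const_mul,
      integral_add hAD.integrable hAd.integrable, e1]
  rw [e6] at e5
  have e7 : (1 + 2 / c ^ 2) * ∫ o, (n' o - n o) ∂P ≤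
      (1 + 2 / c ^ 2) / c * ∫ o, ind Aᶜ o * (n' o - n o) ∂P := by
    rw [div_mul_eq_mul_div, le_div_iff₀ hc, mul_assoc]
    refine mul_le_mul_of_nonneg_left ?_ (by positivity)
    linarith
  rw [← e4]
  refine e5.trans (le_trans ?_ e7)
  have : 0 ≤ 1 / c ^ 2 := by positivity
  have h8 := mul_le_mul_of_nonneg_left e2 this
  have h9 : 2 / c ^ 2 = 2 * (1 / c ^ 2) := by ring
  rw [h9]
  linarith

end Expansion

/-! ### Differentiating generalized inverses. -/

section GeneralizedInverse

open Filter Topology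

/-- Differentiability of a generalized inverse along a path of monotone functions. -/
lemma hasDerivWithinAt_sInf {G : ℝ → ℝ → ℝ} {B a : ℝ → ℝ} {T : Set ℝ} {η b K : ℝ}
    (hb : 0 < b) (hB : HasDerivAt B b η) (hBη : B η = 0) (ha : ContinuousAt a η)
    (hmono : ∀ᶠ t in 𝓝[T] 0, Monotone (G t)) (hmono0 : Monotone (G 0))
    (hexp : ∀ᶠ t in 𝓝[T] 0, ∀ v, |G t v - (B v + t * a v)| ≤ K * t ^ 2)
    (hG0 : ∀ v, G 0 v = B v) :
    HasDerivWithinAt (fun t => sInf {v | 0 ≤ G t v}) (-(a η) / b) T 0 := by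
  have sandwich : ∀ t l u, Monotone (G t) → G t l < 0 → 0 ≤ G t u →
      l ≤ sInf {v | 0 ≤ G t v} ∧ sInf {v | 0 ≤ G t v} ≤ u := by
    intro t l u hm hl hu
    have hlb : ∀ v ∈ {v | 0 ≤ G t v}, l ≤ v := fun v hv => by
      by_contra! h
      exact absurd (hm h.le) (not_le.2 (hl.trans_le hv))
    exact ⟨le_csInf ⟨u, hu⟩ hlb, csInf_le ⟨l, hlb⟩ hu⟩
  have hBo : ∀ ε : ℝ, 0 < ε → ∀ᶠ v in 𝓝 η, |B v - b * (v - η)| ≤ ε * |v - η| := by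
    intro ε hε
    have := (hasDerivAt_iff_isLittleO.1 hB).def hε
    filter_upwards [this] with v hv
    simpa [hBη, mul_comm b] using hv
  have hao : ∀ ε : ℝ, 0 < ε → ∀ᶠ v in 𝓝 η, |a v - a η| ≤ ε := by
    intro ε hε
    filter_upwards [Metric.continuousAt_iff'.1 ha ε hε] with v hv
    exact hv.le
  set d := -(a η) / b with hd
  have hda : b * d + a η = 0 := by rw [hd]; field_simp; ring
  -- The positive slope of `B` forces a strict sign change at `η`, so the infimum is `η` even if `B`
  -- is flat elsewhere.
  have hθ0 : sInf {v | 0 ≤ G 0 v} = η := by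
    have hev := hBo (b / 2) (half_pos hb)
    obtain ⟨δ, hδ, hball⟩ := Metric.eventually_nhds_iff.1 hev
    refine le_antisymm (le_of_forall_pos_le_add fun ε hε => ?_)
      (le_of_forall_pos_le_add fun ε hε => ?_)
    all_goals
      have hε' : 0 < min ε (δ / 2) := lt_min hε (half_pos hδ)
      have hεδ : min ε (δ / 2) < δ := (min_le_right _ _).trans_lt (half_lt_self hδ)
      have hεε : min ε (δ / 2) ≤ ε := min_le_left _ _
      generalize min ε (δ / 2) = e at hε' hεδ hεε
      have h1 := @hball (η + e) (by simpa [abs_of_pos hε'] using hεδ)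
      have h2 := @hball (η - e) (by simpa [Real.dist_eq, abs_of_pos hε'] using hεδ)
      rw [add_sub_cancel_left, abs_of_pos hε', abs_le] at h1
      rw [sub_sub_cancel_left, abs_neg, abs_of_pos hε', abs_le] at h2
      have hbe := mul_pos hb hε'
      have := sandwich 0 (η - e) (η + e) hmono0 (by rw [hG0]; linarith [h2.2])
        (by rw [hG0]; linarith [h1.1])
      linarith [this.1, this.2]
  rw [hasDerivWithinAt_iff_isLittleO, Asymptotics.isLittleO_iff]
  intro ε hε
  simp only [hθ0, sub_zero, smul_eq_mul, Real.norm_eq_abs]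
  set r := |d| + ε with hr
  have hr0 : 0 < r := by positivity
  -- The test points lie within `r * |t|` of `η`. The three errors (expansion, linearization of `B`,
  -- variation of `a`) each cost at most `ε₂ * |t|`, against a margin of `b * ε * |t| = 4 * ε₂ *
  -- |t|`.
  set ε₁ := b * ε / (4 * r) with hε₁
  have hε₁0 : 0 < ε₁ := by positivity
  set ε₂ := b * ε / 4 with hε₂
  have hε₂0 : 0 < ε₂ := by positivity
  have hε₁r : ε₁ * r = ε₂ := by rw [hε₁, hε₂]; field_simp
  have lim : ∀ σ : ℝ, Tendsto (fun t : ℝ => η + t * d + σ * ε * |t|) (𝓝[T] 0) (𝓝 η) := by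
    intro σ
    have : Continuous (fun t : ℝ => η + t * d + σ * ε * |t|) := by fun_prop
    simpa using (this.tendsto 0).mono_left (nhdsWithin_le_nhds (s := T))
  have hK : ∀ᶠ t in 𝓝[T] (0 : ℝ), K * |t| < ε₂ := by
    have : Continuous (fun t : ℝ => K * |t|) := by fun_prop
    have h := (this.tendsto 0).mono_left (nhdsWithin_le_nhds (s := T))
    simp only [abs_zero, mul_zero] at h
    exact h.eventually (gt_mem_nhds hε₂0)
  have hall := (hBo ε₁ hε₁0).and (hao ε₂ hε₂0)
  filter_upwards [(lim 1).eventually hall, (lim (-1)).eventually hall, hmono, hexp, hK]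
    with t h1 h2 hm he hK
  rcases eq_or_ne t 0 with rfl | ht
  · simp [hθ0]
  have ht0 : 0 < |t| := abs_pos.2 ht
  -- The choice of `d` cancels the drift `b * t * d + t * a η`, leaving `σ * b * ε * |t|` as main
  -- term; `σ = 1` and `σ = -1` give the two ends of the sandwich.
  have bound : ∀ σ : ℝ, |σ| = 1 →
      (|B (η + t * d + σ * ε * |t|) - b * (η + t * d + σ * ε * |t| - η)| ≤
        ε₁ * |η + t * d + σ * ε * |t| - η| ∧ |a (η + t * d + σ * ε * |t|) - a η| ≤ ε₂) →
      |G t (η + t * d + σ * ε * |t|) - σ * (b * ε * |t|)| < b * ε * |t| := by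
    intro σ hσ h
    set w := η + t * d + σ * ε * |t| with hw
    have hwη : |w - η| ≤ r * |t| := by
      have : w - η = t * d + σ * ε * |t| := by rw [hw]; ring
      rw [this]
      refine (abs_add_le _ _).trans (le_of_eq ?_)
      rw [abs_mul, abs_mul, abs_mul, hσ, abs_of_pos hε, abs_abs, hr]
      ring
    have e : G t w - σ * (b * ε * |t|) = (G t w - (B w + t * a w)) + (B w - b * (w - η)) +
        t * (a w - a η) := by
      have : b * (w - η) = t * (b * d) + σ * (b * ε * |t|) := by rw [hw]; ring
      have h2 : b * d = - a η := by linarith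
      rw [this, h2]; ring
    rw [e]
    refine (abs_add_le _ _).trans_lt ?_
    have q1 := (abs_add_le (G t w - (B w + t * a w)) (B w - b * (w - η)))
    have q2 := he w
    have q3 := h.1.trans (mul_le_mul_of_nonneg_left hwη hε₁0.le)
    have q4 : |t * (a w - a η)| ≤ |t| * ε₂ := by
      rw [abs_mul]; exact mul_le_mul_of_nonneg_left h.2 ht0.le
    have q5 : K * t ^ 2 < ε₂ * |t| := by
      rw [← sq_abs, sq, ← mul_assoc]
      exact mul_lt_mul_of_pos_right hK ht0
    have q6 : ε₁ * (r * |t|) = ε₂ * |t| := by rw [← mul_assoc, hε₁r]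
    have q7 : b * ε * |t| = 4 * (ε₂ * |t|) := by rw [hε₂]; ring
    have q8 : 0 < ε₂ * |t| := by positivity
    linarith
  have u1 := abs_lt.1 (bound 1 (by simp) h1)
  have u2 := abs_lt.1 (bound (-1) (by simp) h2)
  have := sandwich t _ _ hm (by linarith [u2.2] : G t (η + t * d + -1 * ε * |t|) < 0)
    (by linarith [u1.1] : 0 ≤ G t (η + t * d + 1 * ε * |t|))
  rw [abs_le]
  constructor <;> linarith [this.1, this.2]

/-- A function squeezed between a monotone function and its left limits inherits its derivative. -/
lemma hasDerivAt_of_leftLim {F H : ℝ → ℝ} {η f : ℝ} (hF : HasDerivAt F f η)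
    (hle : ∀ v, H v ≤ F v) (hge : ∀ u v, u < v → F u ≤ H v) :
    H η = F η ∧ HasDerivAt H f η := by
  have hη : H η = F η := by
    refine le_antisymm (hle η) ?_
    have h1 : Tendsto F (𝓝[<] η) (𝓝 (F η)) :=
      hF.continuousAt.tendsto.mono_left nhdsWithin_le_nhds
    exact le_of_tendsto h1 (by filter_upwards [self_mem_nhdsWithin] with u hu using hge u η hu)
  refine ⟨hη, ?_⟩
  -- The point `v - (v - η) ^ 2` is strictly left of `v` for `v ≠ η` but agrees with it to first
  -- order, so `F` there is a lower bound for `H v` with the same derivative at `η`.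
  have hF2 : HasDerivAt (F ∘ fun v => v - (v - η) ^ 2) f η := by
    have hin : HasDerivAt (fun v : ℝ => v - (v - η) ^ 2) 1 η := by
      have := (hasDerivAt_id' η).fun_sub (((hasDerivAt_id' η).sub_const η).fun_pow 2)
      exact this.congr_deriv (by simp)
    have hF' : HasDerivAt F f (η - (η - η) ^ 2) := by simpa using hF
    have := HasDerivAt.comp η hF' hin
    rwa [mul_one] at this
  rw [hasDerivAt_iff_isLittleO] at hF hF2 ⊢
  rw [Asymptotics.isLittleO_iff] at hF hF2 ⊢
  intro ε hε
  filter_upwards [hF hε, hF2 hε] with v h1 h2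
  simp only [Function.comp_apply, sub_self, ne_eq, OfNat.ofNat_ne_zero, not_false_eq_true, zero_pow,
    sub_zero, smul_eq_mul, Real.norm_eq_abs, hη] at h1 h2 ⊢
  rcases eq_or_ne v η with rfl | hv
  · simp [hη]
  · have hlt : v - (v - η) ^ 2 < v := by
      have := sq_pos_of_ne_zero (sub_ne_zero.2 hv)
      linarith
    have h3 := hge _ _ hlt
    have h4 := hle v
    rw [abs_le] at h1 h2 ⊢
    constructor <;> linarith [h1.2, h2.1]

end GeneralizedInverse

/-! ### Pathwise derivatives and uniqueness of influence functions. -/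

section Path

open Filter Topology

variable {𝒪 : Type*} {m mO : MeasurableSpace 𝒪} {P : Measure 𝒪} {A : Set 𝒪} {c : ℝ}
  {s : 𝒪 → ℝ}

/-- The density at `t` is a convex combination of the constant `1` and the nonnegative density at
`t₀`, with weight at least `1 / 2` on the former. No boundedness of `s` is needed. -/
lemma ae_half_le_of_validTimes {t₀ t : ℝ} (h₀ : t₀ ∈ validTimes P s) (hu0 : 0 ≤ t / t₀)
    (hu1 : t / t₀ ≤ 1 / 2) (ht₀ : t₀ ≠ 0) : ∀ᵐ o ∂P, 1 / 2 ≤ 1 + t * s o := by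
  filter_upwards [h₀] with o ho
  have e : 1 + t * s o = (1 - t / t₀) + t / t₀ * (1 + t₀ * s o) := by field_simp; ring
  rw [e]
  have := mul_nonneg hu0 ho
  linarith

/-- Near `t = 0` the density of an admissible path is bounded away from zero. -/
lemma eventually_half_le (P : Measure 𝒪) (s : 𝒪 → ℝ) :
    ∀ᶠ t in 𝓝[validTimes P s] 0, ∀ᵐ o ∂P, 1 / 2 ≤ 1 + t * s o := by
  have hpos : ∀ᶠ t in 𝓝[validTimes P s] (0 : ℝ), 0 < t → ∀ᵐ o ∂P, 1 / 2 ≤ 1 + t * s o := by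
    by_cases h : ∃ t₀ ∈ validTimes P s, 0 < t₀
    · obtain ⟨t₀, h₀, hlt⟩ := h
      have : ∀ᶠ t in 𝓝[validTimes P s] (0 : ℝ), t < t₀ / 2 :=
        nhdsWithin_le_nhds (gt_mem_nhds (half_pos hlt))
      filter_upwards [this] with t ht ht0
      refine ae_half_le_of_validTimes h₀ (div_nonneg ht0.le hlt.le) ?_ hlt.ne'
      rw [div_le_iff₀ hlt]
      linarith
    -- No admissible time is positive, so the claim on this side is vacuous.
    · push Not at h
      filter_upwards [self_mem_nhdsWithin] with t ht ht0
      exact absurd (h t ht) (not_le.2 ht0)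
  have hneg : ∀ᶠ t in 𝓝[validTimes P s] (0 : ℝ), t < 0 → ∀ᵐ o ∂P, 1 / 2 ≤ 1 + t * s o := by
    by_cases h : ∃ t₀ ∈ validTimes P s, t₀ < 0
    · obtain ⟨t₀, h₀, hlt⟩ := h
      have : ∀ᶠ t in 𝓝[validTimes P s] (0 : ℝ), t₀ / 2 < t :=
        nhdsWithin_le_nhds (lt_mem_nhds (by linarith))
      filter_upwards [this] with t ht ht0
      refine ae_half_le_of_validTimes h₀ (div_nonneg_of_nonpos ht0.le hlt.le) ?_ hlt.ne
      rw [div_le_iff_of_neg hlt]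
      linarith
    · push Not at h
      filter_upwards [self_mem_nhdsWithin] with t ht ht0
      exact absurd (h t ht) (not_le.2 ht0)
  filter_upwards [hpos, hneg] with t h1 h2
  rcases lt_trichotomy t 0 with h | h | h
  · exact h2 h
  · refine Eventually.of_forall fun o => ?_
    rw [h]; norm_num
  · exact h1 h

lemma perturb_zero (P : Measure 𝒪) (s : 𝒪 → ℝ) : perturb P s 0 = P := by
  simp [perturb]

/-- Cauchy–Schwarz, from the discriminant of a nonnegative quadratic. -/
lemma sq_integral_mul_le {f k : 𝒪 → ℝ} (hf : MemLp f 2 P) (hk : MemLp k 2 P) :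
    (∫ o, f o * k o ∂P) ^ 2 ≤ (∫ o, f o ^ 2 ∂P) * ∫ o, k o ^ 2 ∂P := by
  have hfk : Integrable (fun o => f o * k o) P := hf.integrable_mul hk
  have key : ∀ x : ℝ, 0 ≤ (∫ o, f o ^ 2 ∂P) * (x * x) + (2 * ∫ o, f o * k o ∂P) * x +
      ∫ o, k o ^ 2 ∂P := by
    intro x
    have h0 : 0 ≤ ∫ o, (x * f o + k o) ^ 2 ∂P := integral_nonneg fun o => sq_nonneg _
    have e : ∫ o, (x * f o + k o) ^ 2 ∂P = ∫ o, ((x * x * f o ^ 2 + 2 * x * (f o * k o)) +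
        k o ^ 2) ∂P := integral_congr_ae (Eventually.of_forall fun o => by ring)
    have hsum : Integrable (fun o => x * x * f o ^ 2 + 2 * x * (f o * k o)) P :=
      (hf.integrable_sq.const_mul _).add (hfk.const_mul _)
    rw [e, integral_add hsum hk.integrable_sq,
      integral_add (hf.integrable_sq.const_mul _) (hfk.const_mul _), integral_const_mul,
      integral_const_mul] at h0
    linarith
  have := discrim_le_zero key
  rw [discrim] at this
  nlinarith

/-- The pathwise derivative of a quantile that is identified through the conditional distribution
on the complement of the missing-data event `Aᶜ`. -/
theorem hasDerivWithinAt_quantile_perturb [IsProbabilityMeasure P] (hm : m ≤ mO)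
    (H : StrictOverlap m P A c)
    (hA : MeasurableSet A) {U : 𝒪 → ℝ} (hU : Measurable U) (hs : MemLp s 2 P)
    {ρ : 𝒪 → ℝ} (hρ : IsOdds m P A c ρ) {p b η : ℝ} (hb : 0 < b)
    (hB : HasDerivAt (fun v => ∫ o, ind Aᶜ o *
      (condExp m (cond P A) (ind {o | U o < v}) o - p) ∂P) b η)
    (hBη : ∫ o, ind Aᶜ o * (condExp m (cond P A) (ind {o | U o < η}) o - p) ∂P = 0) :
    HasDerivWithinAt
      (fun t => sInf {v | p ≤ ∫ o, condExp m (cond (perturb P s t) A) (ind {o | U o < v}) o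
        ∂(cond (perturb P s t) Aᶜ)})
      (-(∫ o, s o * momentGradient A {o | U o < η} ρ
        (condExp m (cond P A) (ind {o | U o < η})) p o ∂P) / b) (validTimes P s) 0 := by
  have hsI : Integrable s P := hs.integrable (by norm_num)
  have hgI : ∀ t : ℝ, Integrable (fun o => 1 + t * s o) P := fun t =>
    (integrable_const _).add (hsI.const_mul t)
  have hSm : ∀ v, MeasurableSet {o | U o < v} := fun v => measurableSet_lt hU measurable_const
  have hSmono : ∀ u v, u ≤ v → {o | U o < u} ⊆ {o | U o < v} := fun u v huv o ho =>
    lt_of_lt_of_le ho huv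
  have hver0 : ∀ v, ∃ n, IsCondProb m P (fun _ => 1) A {o | U o < v} n ∧
      n =ᵐ[P] condExp m (cond P A) (ind {o | U o < v}) := fun v => by
    obtain ⟨n, h1, h2, h3, h4⟩ := exists_version_withDensity hm H hA (hSm v)
      (integrable_const (1 : ℝ)) zero_lt_one (Eventually.of_forall fun _ => le_rfl)
    refine ⟨n, ⟨h1, fun o => (h2 o).1, fun o => (h2 o).2, h4⟩, ?_⟩
    simpa using h3
  choose n hn hneq using hver0
  have hver : ∀ t, (∀ᵐ o ∂P, 1 / 2 ≤ 1 + t * s o) → ∀ v,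
      ∃ n, IsCondProb m P (fun o => 1 + t * s o) A {o | U o < v} n ∧
      n =ᵐ[P] condExp m (cond (perturb P s t) A) (ind {o | U o < v}) := fun t ht v => by
    obtain ⟨n, h1, h2, h3, h4⟩ := exists_version_withDensity hm H hA (hSm v) (hgI t)
      one_half_pos ht
    exact ⟨n, ⟨h1, fun o => (h2 o).1, fun o => (h2 o).2, h4⟩, h3⟩
  set B : ℝ → ℝ := fun v => ∫ o, ind Aᶜ o *
    (condExp m (cond P A) (ind {o | U o < v}) o - p) ∂P with hBdef
  set G : ℝ → ℝ → ℝ := fun t v => ∫ o, (1 + t * s o) * (ind Aᶜ o *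
    (condExp m (cond (perturb P s t) A) (ind {o | U o < v}) o - p)) ∂P with hGdef
  set a : ℝ → ℝ := fun v => ∫ o, s o * momentGradient A {o | U o < v} ρ (n v) p o ∂P with hadef
  have hBn : ∀ v, B v = ∫ o, ind Aᶜ o * (n v o - p) ∂P := fun v =>
    integral_congr_ae (by filter_upwards [hneq v] with o ho; rw [ho])
  have hGn : ∀ t v k, k =ᵐ[P] condExp m (cond (perturb P s t) A) (ind {o | U o < v}) →
      G t v = ∫ o, (1 + t * s o) * (ind Aᶜ o * (k o - p)) ∂P := fun t v k hk =>
    integral_congr_ae (by filter_upwards [hk] with o ho; rw [ho])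
  have hmono : ∀ t, (∀ᵐ o ∂P, 1 / 2 ≤ 1 + t * s o) → Monotone (G t) := by
    intro t ht u v huv
    obtain ⟨k, hk, hke⟩ := hver t ht u
    obtain ⟨k', hk', hke'⟩ := hver t ht v
    rw [hGn t u k hke, hGn t v k' hke']
    have hkk := IsCondProb.mono hm H hA (hSm u) (hSm v) (hSmono u v huv) (hgI t) one_half_pos ht
      hk hk'
    refine integral_mono_ae ?_ ?_ ?_
    · exact ((BddMeas.ind hA.compl).mul
        ((hk.bddMeas.mono hm).sub (BddMeas.const p))).integrable_mul (hgI t)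
    · exact ((BddMeas.ind hA.compl).mul
        ((hk'.bddMeas.mono hm).sub (BddMeas.const p))).integrable_mul (hgI t)
    · filter_upwards [hkk, ht] with o ho ht
      refine mul_le_mul_of_nonneg_left (mul_le_mul_of_nonneg_left ?_ (ind_nonneg _ _)) (by linarith)
      linarith
  have hzero : ∀ᵐ o ∂P, (1 : ℝ) / 2 ≤ 1 + 0 * s o :=
    Eventually.of_forall fun o => by norm_num
  -- Cauchy–Schwarz and the mean-square modulus bound the increment of `a` by a multiple of `√|B v -
  -- B η|`, and `B` is continuous at `η`.
  have ha : ContinuousAt a η := by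
    have hbound : ∀ v, |a v - a η| ≤
        √((∫ o, s o ^ 2 ∂P) * ((1 + 2 / c ^ 2) / c * |B v - B η|)) := by
      intro v
      have hψ : ∀ w, BddMeas mO (momentGradient A {o | U o < w} ρ (n w) p) := fun w =>
        bddMeas_momentGradient hm hA (hSm w) hρ.bddMeas (hn w).bddMeas p
      have e : a v - a η = ∫ o, s o * (momentGradient A {o | U o < v} ρ (n v) p o -
          momentGradient A {o | U o < η} ρ (n η) p o) ∂P := by
        rw [hadef]
        simp only
        rw [← integral_sub ((hψ v).integrable_mul hsI) ((hψ η).integrable_mul hsI)]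
        exact integral_congr_ae (Eventually.of_forall fun o => by ring)
      refine Real.abs_le_sqrt ?_
      rw [e]
      refine (sq_integral_mul_le hs ((hψ v).sub (hψ η)).memLp_two).trans ?_
      refine mul_le_mul_of_nonneg_left ?_ (integral_nonneg fun o => sq_nonneg _)
      rcases le_total η v with h | h
      · refine (integral_momentGradient_sub_sq_le hm H hA (hSm η) (hSm v) (hSmono _ _ h) hρ
          (hn η) (hn v)).trans ?_
        rw [← hBn, ← hBn]
        exact mul_le_mul_of_nonneg_left (le_abs_self _) (by have := H.pos; positivity)
      · have := integral_momentGradient_sub_sq_le (p := p) hm H hA (hSm v) (hSm η)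
          (hSmono _ _ h) hρ (hn v) (hn η)
        rw [← hBn, ← hBn] at this
        simp_rw [← neg_sub (momentGradient A {o | U o < η} ρ (n η) p _), neg_sq]
        rw [abs_sub_comm]
        exact this.trans (mul_le_mul_of_nonneg_left (le_abs_self _) (by have := H.pos; positivity))
    rw [ContinuousAt, tendsto_iff_dist_tendsto_zero]
    refine squeeze_zero (fun _ => dist_nonneg) hbound ?_
    have hcont : ContinuousAt (fun v => √((∫ o, s o ^ 2 ∂P) *
        ((1 + 2 / c ^ 2) / c * |B v - B η|))) η :=
      (continuousAt_const.mul (continuousAt_const.mul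
        (hB.continuousAt.sub continuousAt_const).abs)).sqrt
    simpa [ContinuousAt] using hcont
  have hmain := hasDerivWithinAt_sInf (G := G) (T := validTimes P s) (a := a)
    (K := (1 + 1 / c) * (2 / c) * (∫ o, s o ^ 2 ∂P)) hb hB hBη ha
    ((eventually_half_le P s).mono fun t ht => hmono t ht) (hmono 0 hzero)
    ((eventually_half_le P s).mono fun t ht v => by
      obtain ⟨k, hk, hke⟩ := hver t ht v
      rw [hGn t v k hke, hBn v]
      exact abs_moment_sub_le hm H hA (hSm v) hs hρ ht (hn v) hk)
    (fun v => by simp [hGdef, hBdef, perturb_zero])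
  -- Multiplying the conditional mean by the positive mass of `Aᶜ` turns the level condition at `p`
  -- into a sign condition on `G t`.
  have hset : ∀ t, (∀ᵐ o ∂P, 1 / 2 ≤ 1 + t * s o) →
      sInf {v | p ≤ ∫ o, condExp m (cond (perturb P s t) A) (ind {o | U o < v}) o
        ∂(cond (perturb P s t) Aᶜ)} = sInf {v | 0 ≤ G t v} := by
    intro t ht
    congr 1
    ext v
    obtain ⟨k, hk, hke⟩ := hver t ht v
    have hgm : AEMeasurable (fun o => ENNReal.ofReal (1 + t * s o)) P :=
      (hgI t).1.aemeasurable.ennreal_ofReal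
    have hconv : ∀ k : 𝒪 → ℝ, ∫ o, k o ∂(perturb P s t) = ∫ o, (1 + t * s o) * k o ∂P :=
      fun k => by
        rw [perturb, integral_withDensity_eq_integral_toReal_smul₀ hgm (by simp)]
        refine integral_congr_ae ?_
        filter_upwards [ht] with o ho
        rw [ENNReal.toReal_ofReal (by linarith), smul_eq_mul]
    have hAc : (perturb P s t).real Aᶜ = ∫ o, (1 + t * s o) * ind Aᶜ o ∂P := by
      rw [← hconv]
      exact (integral_indicator_one hA.compl).symm
    have hpos : 0 < (perturb P s t).real Aᶜ := by
      rw [hAc]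
      have h1 := (H.compl hm hA).measure_pos hm hA.compl
      have h2 : 1 / 2 * P.real Aᶜ ≤ ∫ o, (1 + t * s o) * ind Aᶜ o ∂P := by
        rw [← integral_indicator_one hA.compl, ← integral_const_mul]
        refine integral_mono_ae ?_ ((BddMeas.ind hA.compl).integrable_mul (hgI t)) ?_
        · exact (BddMeas.ind hA.compl).integrable.const_mul (1 / 2)
        · filter_upwards [ht] with o ho
          exact mul_le_mul_of_nonneg_right ho (ind_nonneg _ _)
      linarith
    have i1 : Integrable (fun o => (1 + t * s o) * (ind Aᶜ o * k o)) P :=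
      ((BddMeas.ind hA.compl).mul (hk.bddMeas.mono hm)).integrable_mul (hgI t)
    have i2 : Integrable (fun o => p * ((1 + t * s o) * ind Aᶜ o)) P :=
      ((BddMeas.ind hA.compl).integrable_mul (hgI t)).const_mul p
    have e1 : ∫ o, condExp m (cond (perturb P s t) A) (ind {o | U o < v}) o
        ∂(cond (perturb P s t) Aᶜ) =
        ((perturb P s t).real Aᶜ)⁻¹ * ∫ o, (1 + t * s o) * (ind Aᶜ o * k o) ∂P := by
      rw [integral_cond_eq _ hA.compl, hconv]
      congr 1
      exact integral_congr_ae (by filter_upwards [hke] with o ho; rw [ho])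
    have e2 : G t v = ∫ o, (1 + t * s o) * (ind Aᶜ o * k o) ∂P -
        p * (perturb P s t).real Aᶜ := by
      rw [hGn t v k hke, hAc, ← integral_const_mul, ← integral_sub i1 i2]
      exact integral_congr_ae (Eventually.of_forall fun o => by ring)
    simp only [mem_ofPred_eq]
    rw [e1, e2, le_inv_mul_iff₀ hpos, sub_nonneg, mul_comm p]
  have hfinal := hmain.congr_of_eventuallyEq
    ((eventually_half_le P s).mono fun t ht => hset t ht) (hset 0 hzero)
  have haη : a η = ∫ o, s o * momentGradient A {o | U o < η} ρ
        (condExp m (cond P A) (ind {o | U o < η})) p o ∂P :=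
    integral_congr_ae (by
      filter_upwards [hneq η] with o ho
      simp only [momentGradient, ho])
  rwa [haη] at hfinal

/-- A pathwise differentiable parameter has at most one influence function. -/
theorem IsInfluenceFunction.ae_eq [IsProbabilityMeasure P] {θ : Measure 𝒪 → ℝ} {φ ψ : 𝒪 → ℝ}
    (hφ : IsInfluenceFunction θ P φ) (hψ : IsInfluenceFunction θ P ψ) : φ =ᵐ[P] ψ := by
  have hφI : Integrable φ P := hφ.memLp.integrable (by norm_num)
  have hψI : Integrable ψ P := hψ.memLp.integrable (by norm_num)
  refine Integrable.ae_eq_of_forall_setIntegral_eq φ ψ hφI hψI fun S hS _ => ?_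
  -- This score is bounded by `1`, so every `|t| < 1` is admissible and the derivative is two-sided,
  -- hence unique; pairing with it recovers the integral over `S`.
  have hs : BddMeas mO (fun o => ind S o - P.real S) := (BddMeas.ind hS).sub (BddMeas.const _)
  have hs0 : ∫ o, (ind S o - P.real S) ∂P = 0 := by
    rw [integral_sub (BddMeas.ind hS).integrable (integrable_const _)]
    have : ∫ o, ind S o ∂P = P.real S := integral_indicator_one hS
    simp [this]
  have hval : validTimes P (fun o => ind S o - P.real S) ∈ 𝓝 (0 : ℝ) := by
    refine Filter.mem_of_superset (Metric.ball_mem_nhds (0 : ℝ) zero_lt_one) fun t ht => ?_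
    change ∀ᵐ o ∂P, 0 ≤ 1 + t * (ind S o - P.real S)
    refine Eventually.of_forall fun o => ?_
    have h1 : |t| < 1 := by simpa using ht
    have h2 : |ind S o - P.real S| ≤ 1 := abs_le.2
      ⟨by linarith [ind_nonneg S o, measureReal_le_one (μ := P) (s := S)],
        by linarith [ind_le_one S o, measureReal_nonneg (μ := P) (s := S)]⟩
    have h3 : |t * (ind S o - P.real S)| ≤ 1 := by
      rw [abs_mul]; exact mul_le_one₀ h1.le (abs_nonneg _) h2
    linarith [neg_abs_le (t * (ind S o - P.real S))]
  have d1 := (hφ.pathwise _ hs.memLp_two hs0).hasDerivAt hval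
  have d2 := (hψ.pathwise _ hs.memLp_two hs0).hasDerivAt hval
  have heq := d1.unique d2
  have hsplit : ∀ k : 𝒪 → ℝ, Integrable k P → ∫ o, k o ∂P = 0 →
      ∫ o, k o * (ind S o - P.real S) ∂P = ∫ o in S, k o ∂P := by
    intro k hk hk0
    have e : ∫ o, k o * (ind S o - P.real S) ∂P =
        ∫ o, (ind S o * k o - P.real S * k o) ∂P :=
      integral_congr_ae (Eventually.of_forall fun o => by ring)
    have hi : Integrable (fun o => ind S o * k o) P := by
      simpa only [mul_comm] using (BddMeas.ind hS).integrable_mul hk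
    rw [e, integral_sub hi (hk.const_mul _), integral_const_mul, hk0, ind_mul_eq_indicator,
      integral_indicator hS]
    ring
  rwa [hsplit φ hφI hφ.mean_zero, hsplit ψ hψI hψ.mean_zero] at heq

end Path

/-! ### Identification of the target under missingness at random. -/

section Identification

open Filter Topology

/-- Conditional expectations commute with pulling back along a measurable map. -/
lemma condExp_map_comp {Ω 𝒪 : Type*} {m mO : MeasurableSpace 𝒪} [MeasurableSpace Ω]
    (μ : Measure Ω) [IsFiniteMeasure μ] (hm : m ≤ mO) {T : Ω → 𝒪} (hT : Measurable T) {f : 𝒪 → ℝ}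
    (hf : Integrable f (μ.map T)) :
    (condExp m (μ.map T) f) ∘ T =ᵐ[μ] condExp (m.comap T) μ (f ∘ T) := by
  have hle : m.comap T ≤ ‹MeasurableSpace Ω› :=
    (MeasurableSpace.comap_mono hm).trans hT.comap_le
  have hcomp : Measurable[m.comap T, m] T := comap_measurable T
  refine ae_eq_condExp_of_forall_setIntegral_eq hle (hf.comp_measurable hT) ?_ ?_ ?_
  · intro s _ _
    exact (integrable_condExp.comp_measurable hT).integrableOn
  · rintro _ ⟨B, hB, rfl⟩ _
    have h1 := setIntegral_condExp hm hf hB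
    rw [setIntegral_map (hm _ hB) integrable_condExp.1 hT.aemeasurable,
      setIntegral_map (hm _ hB) hf.1 hT.aemeasurable] at h1
    exact h1
  · exact (stronglyMeasurable_condExp.comp_measurable hcomp).aestronglyMeasurable

/-- Under conditional independence of `Z` and `R` given `mW`, the indicator of `R` may be replaced by
its conditional probability when integrating functions of `Z` and an `mW`-measurable `W`. -/
lemma integral_ind_mul_of_condIndepFun {Ω β 𝒲 : Type*} {mW mΩ : MeasurableSpace Ω}
    [StandardBorelSpace Ω] [MeasurableSpace β] [MeasurableSpace 𝒲] {hmWle : mW ≤ mΩ}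
    {μ : Measure Ω} [IsProbabilityMeasure μ] {Z : Ω → β} {R : Ω → Bool} {W : Ω → 𝒲}
    (hZ : Measurable Z) (hR : Measurable R) (hW : Measurable[mW] W)
    (hind : CondIndepFun mW hmWle Z R μ) {k : β × 𝒲 → ℝ} (hk : Measurable k) :
    ∫ ω, ind {ω | R ω = true} ω * k (Z ω, W ω) ∂μ =
      ∫ ω, condExp mW μ (ind {ω | R ω = true}) ω * k (Z ω, W ω) ∂μ := by
  have hZW : Measurable (fun ω => (Z ω, W ω)) := hZ.prodMk (hW.mono hmWle le_rfl)
  have hRs : MeasurableSet {ω | R ω = true} := hR (measurableSet_singleton true)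
  set e := condExp mW μ (ind {ω | R ω = true}) with he
  have heI : Integrable e μ := integrable_condExp
  have he0 : 0 ≤ᵐ[μ] e := condExp_nonneg (Eventually.of_forall (ind_nonneg _))
  have hem : AEMeasurable (fun ω => ENNReal.ofReal (e ω)) μ := heI.1.aemeasurable.ennreal_ofReal
  have : IsFiniteMeasure (μ.withDensity fun ω => ENNReal.ofReal (e ω)) :=
    isFiniteMeasure_withDensity_ofReal heI.2
  -- It suffices to compare finite measures on rectangles, where conditional independence factorizes
  -- the conditional probability.
  have heq : (μ.restrict {ω | R ω = true}).map (fun ω => (Z ω, W ω)) =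
      (μ.withDensity fun ω => ENNReal.ofReal (e ω)).map
        (fun ω => (Z ω, W ω)) := by
    refine Measure.ext_prod fun {s t} hs ht => ?_
    rw [Measure.map_apply hZW (hs.prod ht), Measure.map_apply hZW (hs.prod ht),
      Measure.restrict_apply (hZW (hs.prod ht)), withDensity_apply _ (hZW (hs.prod ht))]
    set a := Z ⁻¹' s with ha
    set b := W ⁻¹' t with hb
    have hab : (fun ω => (Z ω, W ω)) ⁻¹' (s ×ˢ t) = a ∩ b := rfl
    have ham : MeasurableSet a := hZ hs
    have hbm : MeasurableSet[mW] b := hW ht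
    have hbm' : MeasurableSet b := hmWle _ hbm
    rw [hab, ← ofReal_integral_eq_lintegral_ofReal heI.integrableOn (ae_restrict_of_ae he0),
      ← ofReal_measureReal]
    congr 1
    have hprod := (condIndepFun_iff_condExp_inter_preimage_eq_mul hZ hR).1 hind s {true} hs
      (measurableSet_singleton true)
    have l1 : μ.real (a ∩ b ∩ {ω | R ω = true}) =
        ∫ ω, ind b ω * ind (a ∩ R ⁻¹' {true}) ω ∂μ := by
      rw [ind_mul_eq_indicator, integral_indicator hbm']
      have := setIntegral_indicator (μ := μ) (s := b) (t := a ∩ R ⁻¹' {true})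
        (f := fun _ => (1 : ℝ)) (ham.inter (hR (measurableSet_singleton true)))
      rw [this]
      simp only [integral_const, smul_eq_mul, mul_one, measureReal_restrict_apply_univ]
      congr 1
      ext ω
      simp only [mem_inter_iff, mem_ofPred_eq, mem_preimage, mem_singleton_iff]
      tauto
    rw [l1, integral_mul_condExp hmWle μ (BddMeas.ind hbm)
      (BddMeas.ind (ham.inter (hR (measurableSet_singleton true)))).integrable]
    have l2 : ∫ ω in a ∩ b, e ω ∂μ = ∫ ω, (ind b ω * e ω) * ind a ω ∂μ := by
      rw [← integral_indicator (ham.inter hbm')]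
      refine integral_congr_ae (Eventually.of_forall fun ω => ?_)
      by_cases h1 : ω ∈ a <;> by_cases h2 : ω ∈ b <;> simp [h1, h2, ind]
    have hcl : BddMeas mW (fun ω => max 0 (min 1 (e ω))) :=
      BddMeas.clamp stronglyMeasurable_condExp 0 1
    have he1 : e ≤ᵐ[μ] fun _ => (1 : ℝ) := by
      have := condExp_mono (m := mW) ((BddMeas.ind hRs).integrable (P := μ))
        (integrable_const (1 : ℝ)) (Eventually.of_forall (ind_le_one _))
      rwa [condExp_const hmWle] at this
    have hecl : (fun ω => max 0 (min 1 (e ω))) =ᵐ[μ] e := by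
      filter_upwards [he0, he1] with o h0 h1
      rw [min_eq_right h1, max_eq_right (a := (0 : ℝ)) h0]
    have l3 : ∫ ω, (ind b ω * e ω) * ind a ω ∂μ =
        ∫ ω, (ind b ω * max 0 (min 1 (e ω))) * ind a ω ∂μ :=
      integral_congr_ae (by filter_upwards [hecl] with ω h; rw [h])
    rw [l2, l3, integral_mul_condExp hmWle μ ((BddMeas.ind hbm).mul hcl)
      (BddMeas.ind ham).integrable]
    refine integral_congr_ae ?_
    filter_upwards [hprod, hecl] with ω h1 h2
    rw [h2]
    change ind b ω * condExp mW μ ((Z ⁻¹' s ∩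
      R ⁻¹' {true}).indicator fun _ => (1 : ℝ)) ω = _
    rw [h1]
    change ind b ω * (condExp mW μ (ind a) ω * e ω) = _
    ring
  have h1 := integral_map (μ := μ.restrict {ω | R ω = true}) hZW.aemeasurable
    hk.aestronglyMeasurable
  have h2 := integral_map (μ := μ.withDensity fun ω => ENNReal.ofReal (e ω)) hZW.aemeasurable
    hk.aestronglyMeasurable
  rw [heq, h2] at h1
  rw [ind_mul_eq_indicator {ω | R ω = true} fun ω => k (Z ω, W ω),
    integral_indicator hRs, ← h1,
    integral_withDensity_eq_integral_toReal_smul₀ hem (by simp)]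
  refine integral_congr_ae ?_
  filter_upwards [he0] with ω h
  rw [ENNReal.toReal_ofReal h, smul_eq_mul]

/-- The event that the outcome is observed. -/
abbrev responded (𝒳 : Type*) : Set (Obs 𝒳) := {o | Obs.r o = true}

lemma compl_responded {𝒳 : Type*} : (responded 𝒳)ᶜ = {o | Obs.r o = false} := by
  ext o; simp [responded]

variable {Ω 𝒳 : Type*} [MeasurableSpace Ω] [MeasurableSpace 𝒳]
  {μ : Measure Ω} {X : Ω → 𝒳} {D R : Ω → Bool} {Y : Bool → Ω → ℝ}

/-- The `σ`-algebra on the observed data generated by covariates and treatment. -/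
abbrev covariates (𝒳 : Type*) [MeasurableSpace 𝒳] : MeasurableSpace (Obs 𝒳) :=
  MeasurableSpace.comap (fun o : Obs 𝒳 => (Obs.x o, Obs.d o)) inferInstance

lemma measurable_obs_covariates : Measurable (fun o : Obs 𝒳 => (Obs.x o, Obs.d o)) :=
  measurable_fst.prodMk (measurable_fst.comp measurable_snd)

lemma covariates_le : covariates 𝒳 ≤ (inferInstance : MeasurableSpace (Obs 𝒳)) :=
  measurable_obs_covariates.comap_le

lemma measurableSet_responded : MeasurableSet (responded 𝒳) :=
  (measurable_fst.comp (measurable_snd.comp measurable_snd)) (measurableSet_singleton true)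

lemma measurable_observedOutcome (hD : Measurable D) (hY : ∀ d, Measurable (Y d)) :
    Measurable (fun ω => Y (D ω) ω) := by
  have : (fun ω => Y (D ω) ω) = fun ω => if D ω = true then Y true ω else Y false ω := by
    ext ω; cases D ω <;> rfl
  rw [this]
  exact Measurable.ite (hD (measurableSet_singleton true)) (hY true) (hY false)

lemma measurable_observe (hX : Measurable X) (hD : Measurable D) (hR : Measurable R)
    (hY : ∀ d, Measurable (Y d)) : Measurable (observe X D R Y) :=
  hX.prodMk (hD.prodMk (hR.prodMk (Measurable.ite (hR (measurableSet_singleton true))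
    (measurable_observedOutcome hD hY) measurable_const)))

lemma real_response_eq (hX : Measurable X) (hD : Measurable D)
    (hR : Measurable R) (hY : ∀ d, Measurable (Y d)) :
    (μ.map (observe X D R Y)).real (responded 𝒳)ᶜ = μ.real {ω | R ω = false} := by
  rw [map_measureReal_apply (measurable_observe hX hD hR hY) measurableSet_responded.compl]
  congr 1
  ext ω
  simp [responded, observe, Obs.r]

variable [IsProbabilityMeasure μ]

lemma responseProb_observe (hX : Measurable X) (hD : Measurable D) (hR : Measurable R)
    (hY : ∀ d, Measurable (Y d)) (b : Bool) :
    (responseProb (μ.map (observe X D R Y)) Obs.x Obs.d Obs.r b) ∘ observe X D R Y =ᵐ[μ]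
      responseProb μ X D R b := by
  have hT := measurable_observe hX hD hR hY
  have : IsProbabilityMeasure (μ.map (observe X D R Y)) :=
    Measure.isProbabilityMeasure_map hT.aemeasurable
  have hS : MeasurableSet {o : Obs 𝒳 | Obs.r o = b} :=
    (measurable_fst.comp (measurable_snd.comp measurable_snd)) (measurableSet_singleton b)
  have := condExp_map_comp μ covariates_le hT
    ((BddMeas.ind hS).integrable (P := μ.map (observe X D R Y)))
  rw [covariates, MeasurableSpace.comap_comp] at this
  exact this

lemma strictOverlap_observe (hX : Measurable X) (hD : Measurable D) (hR : Measurable R)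
    (hY : ∀ d, Measurable (Y d)) (ho : Overlap μ X D R) :
    ∃ c, StrictOverlap (covariates 𝒳) (μ.map (observe X D R Y)) (responded 𝒳) c := by
  obtain ⟨c, hc, h⟩ := ho
  have hT := measurable_observe hX hD hR hY
  refine ⟨c, hc, ?_⟩
  have hmeas : Measurable (condExp (covariates 𝒳) (μ.map (observe X D R Y))
      (ind (responded 𝒳))) := (stronglyMeasurable_condExp.mono covariates_le).measurable
  have hset : MeasurableSet {o | c < condExp (covariates 𝒳) (μ.map (observe X D R Y))
      (ind (responded 𝒳)) o ∧ condExp (covariates 𝒳) (μ.map (observe X D R Y))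
      (ind (responded 𝒳)) o < 1 - c} :=
    (measurableSet_lt measurable_const hmeas).inter (measurableSet_lt hmeas measurable_const)
  rw [ae_map_iff hT.aemeasurable hset]
  filter_upwards [h, responseProb_observe (μ := μ) hX hD hR hY true] with ω hω he
  have he' : condExp (covariates 𝒳) (μ.map (observe X D R Y)) (ind (responded 𝒳))
      (observe X D R Y ω) = responseProb μ X D R true ω := he
  rw [he']
  exact hω.2

/-- Under missingness at random, the response indicator may be replaced by the response probability
when integrating functions of potential outcomes, covariates and treatment. -/
lemma integral_response_mul [StandardBorelSpace Ω] (hX : Measurable X) (hD : Measurable D)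
    (hR : Measurable R) (hY : ∀ d, Measurable (Y d)) (hMAR : MissingAtRandom μ hX hD R Y)
    {k : (ℝ × ℝ) × (𝒳 × Bool) → ℝ} (hk : Measurable k) :
    ∫ ω, ind {ω | R ω = true} ω * k ((Y true ω, Y false ω), (X ω, D ω)) ∂μ =
      ∫ ω, responseProb μ X D R true ω * k ((Y true ω, Y false ω), (X ω, D ω)) ∂μ :=
  integral_ind_mul_of_condIndepFun ((hY true).prodMk (hY false)) hR (comap_measurable _) hMAR hk

variable {v : 𝒳 → Bool → ℝ → ℝ}

lemma measurable_fullScore (hX : Measurable X) (hD : Measurable D) (hY : ∀ d, Measurable (Y d))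
    (hv : Measurable fun q : 𝒳 × Bool × ℝ => v q.1 q.2.1 q.2.2) :
    Measurable (fun ω => v (X ω) (D ω) (Y (D ω) ω)) :=
  hv.comp (hX.prodMk (hD.prodMk (measurable_observedOutcome hD hY)))

lemma measurable_obs_score (hv : Measurable fun q : 𝒳 × Bool × ℝ => v q.1 q.2.1 q.2.2) :
    Measurable (fun o : Obs 𝒳 => v (Obs.x o) (Obs.d o) (Obs.y o)) :=
  hv.comp (measurable_fst.prodMk ((measurable_fst.comp measurable_snd).prodMk
    (measurable_snd.comp (measurable_snd.comp measurable_snd))))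

lemma isProbabilityMeasure_attritionLaw (hX : Measurable X) (hD : Measurable D)
    (hR : Measurable R) (hY : ∀ d, Measurable (Y d))
    (hv : Measurable fun q : 𝒳 × Bool × ℝ => v q.1 q.2.1 q.2.2) (ho : Overlap μ X D R) :
    IsProbabilityMeasure (attritionLaw μ X D R Y v) := by
  obtain ⟨c, H⟩ := strictOverlap_observe hX hD hR hY ho
  have : IsProbabilityMeasure (μ.map (observe X D R Y)) :=
    Measure.isProbabilityMeasure_map (measurable_observe hX hD hR hY).aemeasurable
  have hpos := (H.compl covariates_le measurableSet_responded).measure_pos covariates_le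
    measurableSet_responded.compl
  rw [real_response_eq hX hD hR hY] at hpos
  have : IsProbabilityMeasure (cond μ {ω | R ω = false}) :=
    cond_isProbabilityMeasure fun h => by simp [measureReal_def, h] at hpos
  exact Measure.isProbabilityMeasure_map (measurable_fullScore hX hD hY hv).aemeasurable

/-- Identification: the observed-data moment is the distribution of the score given attrition. -/
theorem integral_mC_eq_attritionLaw [StandardBorelSpace Ω] (hX : Measurable X) (hD : Measurable D)
    (hR : Measurable R) (hY : ∀ d, Measurable (Y d)) (hMAR : MissingAtRandom μ hX hD R Y)
    (ho : Overlap μ X D R) (hv : Measurable fun q : 𝒳 × Bool × ℝ => v q.1 q.2.1 q.2.2) (η : ℝ) :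
    ∫ o, mC v (μ.map (observe X D R Y)) η o
        ∂(cond (μ.map (observe X D R Y)) (responded 𝒳)ᶜ) =
      (attritionLaw μ X D R Y v).real (Iio η) := by
  obtain ⟨c, H⟩ := strictOverlap_observe hX hD hR hY ho
  have hT := measurable_observe hX hD hR hY
  have hA : MeasurableSet (responded 𝒳) := measurableSet_responded
  set P := μ.map (observe X D R Y) with hP
  have : IsProbabilityMeasure P := Measure.isProbabilityMeasure_map hT.aemeasurable
  have hS : MeasurableSet {o : Obs 𝒳 | v (Obs.x o) (Obs.d o) (Obs.y o) < η} :=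
    measurableSet_lt (measurable_obs_score hv) measurable_const
  have hRf : MeasurableSet {ω | R ω = false} := hR (measurableSet_singleton false)
  have hRt : MeasurableSet {ω | R ω = true} := hR (measurableSet_singleton true)
  have hfull := measurable_fullScore hX hD hY hv
  have hF : MeasurableSet {ω | v (X ω) (D ω) (Y (D ω) ω) < η} :=
    measurableSet_lt hfull measurable_const
  obtain ⟨n, hn, -, hneq, hnint⟩ := exists_version_withDensity covariates_le H hA hS
    (integrable_const (1 : ℝ)) zero_lt_one (Eventually.of_forall fun _ => le_rfl)
  simp only [ENNReal.ofReal_one, withDensity_const, one_smul, one_mul] at hneq hnint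
  obtain ⟨ρ, hρ, -, hρeq, hρint⟩ := H.exists_odds covariates_le hA
  -- The odds are a function of `(x, d)`, so they can be evaluated on the original space.
  obtain ⟨κ, hκ, hκeq⟩ := hρ.meas.exists_eq_measurable_comp
  have hright : (attritionLaw μ X D R Y v).real (Iio η) = (μ.real {ω | R ω = false})⁻¹ *
      ∫ ω, ind {ω | R ω = false} ω * ind {ω | v (X ω) (D ω) (Y (D ω) ω) < η} ω ∂μ := by
    rw [← integral_cond_eq μ hRf, attritionLaw, map_measureReal_apply hfull measurableSet_Iio]
    exact (integral_indicator_one hF).symm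
  rw [hright, integral_cond_eq P hA.compl, real_response_eq hX hD hR hY]
  congr 1
  -- Inverse weighting: the odds carry the integral from nonrespondents to respondents, where `mC`
  -- may be replaced by the indicator it predicts.
  have s1 : ∫ o, ind (responded 𝒳)ᶜ o * mC v P η o ∂P =
      ∫ o, ind (responded 𝒳) o *
        (ρ o * ind {o : Obs 𝒳 | v (Obs.x o) (Obs.d o) (Obs.y o) < η} o) ∂P := by
    rw [hnint ρ hρ, ← hρint n hn]
    refine integral_congr_ae ?_
    filter_upwards [hneq] with o h
    rw [h]
    rfl
  have hkm : Measurable fun z : (ℝ × ℝ) × (𝒳 × Bool) =>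
      v z.2.1 z.2.2 (if z.2.2 = true then z.1.1 else z.1.2) := by
    refine hv.comp ((measurable_fst.comp measurable_snd).prodMk
      ((measurable_snd.comp measurable_snd).prodMk (Measurable.ite
        ((measurable_snd.comp measurable_snd) (measurableSet_singleton true))
        (measurable_fst.comp measurable_fst) (measurable_snd.comp measurable_fst))))
  have hki : Measurable (ind {z : (ℝ × ℝ) × (𝒳 × Bool) |
      v z.2.1 z.2.2 (if z.2.2 = true then z.1.1 else z.1.2) < η}) :=
    measurable_const.indicator (measurableSet_lt hkm measurable_const)
  have hkval : ∀ ω, ind {z : (ℝ × ℝ) × (𝒳 × Bool) |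
      v z.2.1 z.2.2 (if z.2.2 = true then z.1.1 else z.1.2) < η}
        ((Y true ω, Y false ω), (X ω, D ω)) =
      ind {ω | v (X ω) (D ω) (Y (D ω) ω) < η} ω := by
    intro ω
    simp only [ind, indicator, mem_ofPred_eq]
    cases D ω <;> rfl
  have s2 : ∫ o, ind (responded 𝒳) o *
        (ρ o * ind {o : Obs 𝒳 | v (Obs.x o) (Obs.d o) (Obs.y o) < η} o) ∂P =
      ∫ ω, ind {ω | R ω = true} ω *
        (κ (X ω, D ω) * ind {ω | v (X ω) (D ω) (Y (D ω) ω) < η} ω) ∂μ := by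
    rw [hP, integral_map hT.aemeasurable]
    · refine integral_congr_ae (Eventually.of_forall fun ω => ?_)
      simp only [hκeq, Function.comp_apply]
      by_cases h : R ω = true
      · simp [ind, indicator, observe, responded, Obs.r, Obs.x, Obs.d, Obs.y, h]
      · simp [ind, indicator, observe, responded, Obs.r, h]
    · exact ((BddMeas.ind hA).mul
        ((hρ.mono covariates_le).mul (BddMeas.ind hS))).meas.aestronglyMeasurable
  have s3 := integral_response_mul hX hD hR hY hMAR
    ((hκ.measurable.comp measurable_snd).mul hki)
  have s4 := integral_response_mul hX hD hR hY hMAR hki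
  simp only [Pi.mul_apply, Function.comp_apply, hkval] at s3 s4
  -- Probability times odds is `1 - e_R`. Missingness at random is used twice: `s3` replaces the
  -- response indicator by `e_R`, and `s4` puts it back after the weights have cancelled.
  have hodds : ∀ᵐ ω ∂μ, responseProb μ X D R true ω * κ (X ω, D ω) =
      1 - responseProb μ X D R true ω := by
    have h1 := ae_of_ae_map hT.aemeasurable hρeq
    have h2 := ae_of_ae_map hT.aemeasurable
      (StrictOverlap.condExp_compl (P := P) covariates_le hA)
    have h3 := ae_of_ae_map hT.aemeasurable H.bounds
    filter_upwards [h1, h2, h3, responseProb_observe (μ := μ) hX hD hR hY true]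
      with ω h1 h2 h3 h4
    have h4' : condExp (covariates 𝒳) P (ind (responded 𝒳)) (observe X D R Y ω) =
      responseProb μ X D R true ω := h4
    rw [h2, h4', hκeq] at h1
    rw [h4'] at h3
    change κ (X ω, D ω) = _ at h1
    have : responseProb μ X D R true ω ≠ 0 := (H.pos.trans h3.1).ne'
    rw [h1]
    field_simp
  have hFI : Integrable (ind {ω | v (X ω) (D ω) (Y (D ω) ω) < η}) μ := (BddMeas.ind hF).integrable
  have heI : Integrable (responseProb μ X D R true) μ := integrable_condExp
  rw [s1, s2, s3]
  have s5 : ∫ ω, responseProb μ X D R true ω *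
        (κ (X ω, D ω) * ind {ω | v (X ω) (D ω) (Y (D ω) ω) < η} ω) ∂μ =
      ∫ ω, (ind {ω | v (X ω) (D ω) (Y (D ω) ω) < η} ω -
        responseProb μ X D R true ω * ind {ω | v (X ω) (D ω) (Y (D ω) ω) < η} ω) ∂μ := by
    refine integral_congr_ae ?_
    filter_upwards [hodds] with ω h
    rw [← mul_assoc, h]
    ring
  have s6 : ∫ ω, ind {ω | R ω = false} ω * ind {ω | v (X ω) (D ω) (Y (D ω) ω) < η} ω ∂μ =
      ∫ ω, (ind {ω | v (X ω) (D ω) (Y (D ω) ω) < η} ω -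
        ind {ω | R ω = true} ω * ind {ω | v (X ω) (D ω) (Y (D ω) ω) < η} ω) ∂μ := by
    refine integral_congr_ae (Eventually.of_forall fun ω => ?_)
    cases h : R ω <;> simp [ind, indicator, h]
  rw [s5, s6, integral_sub hFI ((BddMeas.ind hF).integrable_mul heI),
    integral_sub hFI ((BddMeas.ind hRt).mul (BddMeas.ind hF)).integrable, s4]

/-- The quantile of a law on the line does not depend on whether the distribution function is
taken right- or left-continuous. -/
lemma quantile_eq_sInf_Iio (ν : Measure ℝ) [IsProbabilityMeasure ν] {p : ℝ} (h0 : 0 < p)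
    (h1 : p < 1) : quantile ν p = sInf {v | p ≤ ν.real (Iio v)} := by
  have hsub : ∀ v, ν.real (Iio v) ≤ cdf ν v := fun v => by
    rw [cdf_eq_real]; exact measureReal_mono Iio_subset_Iic_self
  have hlt : ∀ u w, u < w → cdf ν u ≤ ν.real (Iio w) := fun u w h => by
    rw [cdf_eq_real]; exact measureReal_mono (Iic_subset_Iio.2 h)
  have hne : {v | p ≤ cdf ν v}.Nonempty :=
    (((tendsto_cdf_atTop ν).eventually (lt_mem_nhds h1)).exists).imp fun v hv => hv.le
  have hne' : {v | p ≤ ν.real (Iio v)}.Nonempty := by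
    obtain ⟨u, hu⟩ := hne
    exact ⟨u + 1, le_trans hu (hlt u (u + 1) (by linarith))⟩
  have hbdd : BddBelow {v | p ≤ cdf ν v} := by
    obtain ⟨l, hl⟩ := ((tendsto_cdf_atBot ν).eventually (gt_mem_nhds h0)).exists
    refine ⟨l, fun v hv => ?_⟩
    by_contra! h
    exact absurd (le_trans hv (monotone_cdf ν h.le)) (not_le.2 hl)
  have hss : {v | p ≤ ν.real (Iio v)} ⊆ {v | p ≤ cdf ν v} := fun v hv => le_trans hv (hsub v)
  refine le_antisymm (csInf_le_csInf hbdd hne' hss) (le_csInf hne fun u hu => ?_)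
  refine le_of_forall_pos_le_add fun ε hε => csInf_le (hbdd.mono hss) ?_
  exact le_trans hu (hlt u (u + ε) (by linarith))

/-- The distribution function is below `p` left of the quantile and at least `p` right of it;
continuity closes the gap. -/
lemma cdf_quantile_eq {ν : Measure ℝ} [IsProbabilityMeasure ν] {p : ℝ} (h0 : 0 < p) (h1 : p < 1)
    (hc : ContinuousAt (cdf ν) (quantile ν p)) : cdf ν (quantile ν p) = p := by
  have hne : {v | p ≤ cdf ν v}.Nonempty :=
    (((tendsto_cdf_atTop ν).eventually (lt_mem_nhds h1)).exists).imp fun v hv => hv.le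
  have hbdd : BddBelow {v | p ≤ cdf ν v} := by
    obtain ⟨l, hl⟩ := ((tendsto_cdf_atBot ν).eventually (gt_mem_nhds h0)).exists
    refine ⟨l, fun v hv => ?_⟩
    by_contra! h
    exact absurd (le_trans hv (monotone_cdf ν h.le)) (not_le.2 hl)
  refine le_antisymm ?_ ?_
  · refine le_of_tendsto (hc.tendsto.mono_left (nhdsWithin_le_nhds (s := Iio (quantile ν p)))) ?_
    filter_upwards [self_mem_nhdsWithin] with u hu
    by_contra! h
    exact absurd (csInf_le hbdd (show u ∈ {v | p ≤ cdf ν v} from h.le)) (not_le.2 hu)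
  · refine ge_of_tendsto (hc.tendsto.mono_left (nhdsWithin_le_nhds (s := Ioi (quantile ν p)))) ?_
    filter_upwards [self_mem_nhdsWithin] with u hu
    obtain ⟨w, hw, hwu⟩ := (csInf_lt_iff hbdd hne).1 (show sInf {v | p ≤ cdf ν v} < u from hu)
    exact le_trans hw (monotone_cdf ν hwu.le)

theorem quantile_attritionLaw_eq_etaC [StandardBorelSpace Ω] (hX : Measurable X)
    (hD : Measurable D) (hR : Measurable R) (hY : ∀ d, Measurable (Y d))
    (hMAR : MissingAtRandom μ hX hD R Y) (ho : Overlap μ X D R)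
    (hv : Measurable fun q : 𝒳 × Bool × ℝ => v q.1 q.2.1 q.2.2) {p : ℝ} (h0 : 0 < p)
    (h1 : p < 1) :
    quantile (attritionLaw μ X D R Y v) p = etaC v p (μ.map (observe X D R Y)) := by
  have := isProbabilityMeasure_attritionLaw hX hD hR hY hv ho
  rw [quantile_eq_sInf_Iio _ h0 h1, etaC, ← compl_responded]
  simp_rw [integral_mC_eq_attritionLaw hX hD hR hY hMAR ho hv]

end Identification

/-! ### The efficient influence function. -/

section Main

variable {Ω 𝒳 : Type*} [MeasurableSpace Ω] [MeasurableSpace 𝒳]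

lemma measurable_intervalScore {lo hi : Bool → 𝒳 → ℝ} (hlo : ∀ d, Measurable (lo d))
    (hhi : ∀ d, Measurable (hi d)) {V : 𝒳 × (ℝ × ℝ) → ℝ} (hV : Measurable V) :
    Measurable fun q : 𝒳 × Bool × ℝ => intervalScore V lo hi q.1 q.2.1 q.2.2 := by
  have hx : Measurable fun q : 𝒳 × Bool × ℝ => q.1 := measurable_fst
  have hy : Measurable fun q : 𝒳 × Bool × ℝ => q.2.2 := measurable_snd.comp measurable_snd
  have hd : Measurable fun q : 𝒳 × Bool × ℝ => q.2.1 := measurable_fst.comp measurable_snd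
  refine hV.comp (hx.prodMk ?_)
  exact Measurable.ite (hd (measurableSet_singleton true))
    ((hy.sub ((hhi false).comp hx)).prodMk (hy.sub ((hlo false).comp hx)))
    ((((hlo true).comp hx).sub hy).prodMk (((hhi true).comp hx).sub hy))

/-- `ψ_C` in terms of the response event and the response odds. -/
lemma psiC_ae_eq {v : 𝒳 → Bool → ℝ → ℝ} {P : Measure (Obs 𝒳)} {ρ n : Obs 𝒳 → ℝ} {γ η : ℝ}
    (hρ : ρ =ᵐ[P] fun o => condExp (covariates 𝒳) P (ind (responded 𝒳)ᶜ) o /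
      condExp (covariates 𝒳) P (ind (responded 𝒳)) o)
    (hn : n =ᵐ[P] mC v P η) :
    psiC v P γ η =ᵐ[P] momentGradient (responded 𝒳)
      {o | v (Obs.x o) (Obs.d o) (Obs.y o) < η} ρ n (1 - γ) := by
  filter_upwards [hρ, hn] with o h1 h2
  have hpi : piR P o = condExp (covariates 𝒳) P (ind (responded 𝒳)) o /
      condExp (covariates 𝒳) P (ind (responded 𝒳)ᶜ) o := by
    rw [compl_responded]; rfl
  simp only [psiC, momentGradient]
  rw [h1, h2, hpi]
  by_cases hr : Obs.r o = true
  · simp [ind, indicator, responded, hr]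
  · simp [ind, indicator, responded, hr]

theorem isEfficientInfluenceFunction_psiC {v : 𝒳 → Bool → ℝ → ℝ}
    (hv : Measurable fun q : 𝒳 × Bool × ℝ => v q.1 q.2.1 q.2.2) {P : Measure (Obs 𝒳)}
    [IsProbabilityMeasure P] {c : ℝ} (H : StrictOverlap (covariates 𝒳) P (responded 𝒳) c)
    {γ η f : ℝ} (hf : 0 < f)
    (hder : HasDerivAt (fun u => ∫ o, mC v P u o ∂(cond P (responded 𝒳)ᶜ)) f η)
    (hval : ∫ o, mC v P η o ∂(cond P (responded 𝒳)ᶜ) = 1 - γ) :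
    IsEfficientInfluenceFunction (etaC v (1 - γ)) P
      (fun o => -1 / (P.real (responded 𝒳)ᶜ * f) * psiC v P γ η o) := by
  have hA : MeasurableSet (responded 𝒳) := measurableSet_responded
  have hU := measurable_obs_score hv
  have hS : ∀ u, MeasurableSet {o : Obs 𝒳 | v (Obs.x o) (Obs.d o) (Obs.y o) < u} := fun u =>
    measurableSet_lt hU measurable_const
  have hpos := (H.compl covariates_le hA).measure_pos covariates_le hA.compl
  have hver : ∀ u, ∃ n, IsCondProb (covariates 𝒳) P (fun _ => 1) (responded 𝒳)
      {o | v (Obs.x o) (Obs.d o) (Obs.y o) < u} n ∧ n =ᵐ[P] mC v P u := fun u => by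
    obtain ⟨n, h1, h2, h3, h4⟩ := exists_version_withDensity covariates_le H hA (hS u)
      (integrable_const (1 : ℝ)) zero_lt_one (Filter.Eventually.of_forall fun _ => le_rfl)
    refine ⟨n, ⟨h1, fun o => (h2 o).1, fun o => (h2 o).2, h4⟩, ?_⟩
    simp only [ENNReal.ofReal_one, withDensity_const, one_smul] at h3
    exact h3
  obtain ⟨ρ, hρ1, hρ2, hρeq, hρint⟩ := H.exists_odds covariates_le hA
  have hρ : IsOdds (covariates 𝒳) P (responded 𝒳) c ρ :=
    ⟨hρ1, fun o => (hρ2 o).1, fun o => (hρ2 o).2, hρint⟩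
  -- The moment is the centred conditional distribution function scaled by the mass of nonresponse,
  -- which is where this factor in the constant comes from.
  have hBeq : ∀ u, ∫ o, ind (responded 𝒳)ᶜ o * (mC v P u o - (1 - γ)) ∂P =
      P.real (responded 𝒳)ᶜ *
        (∫ o, mC v P u o ∂(cond P (responded 𝒳)ᶜ) - (1 - γ)) := fun u => by
    obtain ⟨n, hn, hneq⟩ := hver u
    have i1 : Integrable (fun o => ind (responded 𝒳)ᶜ o * mC v P u o) P :=
      ((BddMeas.ind hA.compl).mul (hn.bddMeas.mono covariates_le)).integrable.congr
        (by filter_upwards [hneq] with o ho; rw [ho])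
    have i2 : Integrable (fun o => ind (responded 𝒳)ᶜ o * (1 - γ)) P :=
      (BddMeas.ind hA.compl).integrable.mul_const _
    have e : ∫ o, ind (responded 𝒳)ᶜ o ∂P = P.real (responded 𝒳)ᶜ :=
      integral_indicator_one hA.compl
    have e' : ∫ o, ind (responded 𝒳)ᶜ o * (mC v P u o - (1 - γ)) ∂P =
        ∫ o, (ind (responded 𝒳)ᶜ o * mC v P u o - ind (responded 𝒳)ᶜ o * (1 - γ)) ∂P :=
      integral_congr_ae (Filter.Eventually.of_forall fun o => mul_sub _ _ _)
    rw [e', integral_cond_eq P hA.compl, integral_sub i1 i2, integral_mul_const, e]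
    field_simp
  have hB : HasDerivAt (fun u => ∫ o, ind (responded 𝒳)ᶜ o * (mC v P u o - (1 - γ)) ∂P)
      (P.real (responded 𝒳)ᶜ * f) η := by
    simp_rw [hBeq]
    exact (hder.sub_const _).const_mul _
  have hBη : ∫ o, ind (responded 𝒳)ᶜ o * (mC v P η o - (1 - γ)) ∂P = 0 := by
    rw [hBeq, hval, sub_self, mul_zero]
  obtain ⟨n, hn, hneq⟩ := hver η
  -- Two representatives are needed: the bounded version `n` for integrability and mean zero, and
  -- `mC` itself to match the derivative formula.
  have hψ := psiC_ae_eq (γ := γ) hρeq hneq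
  have hψ' := psiC_ae_eq (γ := γ) (n := mC v P η) hρeq Filter.EventuallyEq.rfl
  have hbdd := bddMeas_momentGradient covariates_le hA (hS η) hρ1 hn.bddMeas (1 - γ)
  have hinf : IsInfluenceFunction (etaC v (1 - γ)) P
      (fun o => -1 / (P.real (responded 𝒳)ᶜ * f) * psiC v P γ η o) := by
    refine ⟨(hbdd.memLp_two.ae_eq hψ.symm).const_mul _, ?_, fun s hs _ => ?_⟩
    · rw [integral_const_mul, integral_congr_ae hψ,
        integral_momentGradient covariates_le hA (hS η) hρ1 hn]
      have : ∫ o, ind (responded 𝒳)ᶜ o * (n o - (1 - γ)) ∂P = 0 := by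
        rw [← hBη]
        exact integral_congr_ae (by filter_upwards [hneq] with o ho; rw [ho])
      rw [this, mul_zero]
    · have hmain := hasDerivWithinAt_quantile_perturb covariates_le H hA hU hs hρ
        (mul_pos hpos hf) hB hBη
      have hval : ∫ o, -1 / (P.real (responded 𝒳)ᶜ * f) * psiC v P γ η o * s o ∂P =
          -(∫ o, s o * momentGradient (responded 𝒳)
            {o | v (Obs.x o) (Obs.d o) (Obs.y o) < η} ρ (mC v P η) (1 - γ) o ∂P) /
            (P.real (responded 𝒳)ᶜ * f) := by
        simp_rw [mul_assoc]
        rw [integral_const_mul]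
        have : ∫ o, psiC v P γ η o * s o ∂P = ∫ o, s o * momentGradient (responded 𝒳)
            {o | v (Obs.x o) (Obs.d o) (Obs.y o) < η} ρ (mC v P η) (1 - γ) o ∂P :=
          integral_congr_ae (by filter_upwards [hψ'] with o ho; rw [ho, mul_comm])
        rw [this]
        ring
      rw [hval]
      have heta : (fun t => etaC v (1 - γ) (perturb P s t)) = fun t =>
          sInf {u | 1 - γ ≤ ∫ o, condExp (covariates 𝒳) (cond (perturb P s t) (responded 𝒳))
            (ind {o | v (Obs.x o) (Obs.d o) (Obs.y o) < u}) o
            ∂(cond (perturb P s t) (responded 𝒳)ᶜ)} := by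
        ext t
        rw [etaC, compl_responded]
        rfl
      rw [heta]
      exact hmain
  exact ⟨hinf, fun φ hφ => hφ.ae_eq hinf⟩

end Main

end Attrition

end

theorem theorem2 {Ω 𝒳 : Type*} [MeasurableSpace Ω] [StandardBorelSpace Ω] [MeasurableSpace 𝒳]
    (μ : Measure Ω) [IsProbabilityMeasure μ]
    (X : Ω → 𝒳) (D R : Ω → Bool) (Y : Bool → Ω → ℝ)
    (hX : Measurable X) (hD : Measurable D) (hR : Measurable R) (hY : ∀ d, Measurable (Y d))
    (lo hi : Bool → 𝒳 → ℝ) (hlo : ∀ d, Measurable (lo d)) (hhi : ∀ d, Measurable (hi d))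
    (V : 𝒳 × (ℝ × ℝ) → ℝ) (hV : Measurable V)
    (γ : ℝ) (hγ₀ : 0 < γ) (hγ₁ : γ < 1)
    (hMAR : Attrition.MissingAtRandom μ hX hD R Y)
    (hoverlap : Attrition.Overlap μ X D R)
    (hodds : Integrable (fun ω => Attrition.responseProb μ X D R false ω ^ 2 /
      Attrition.responseProb μ X D R true ω) μ)
    (η : ℝ)
    (hη : η = Attrition.quantile
      (Attrition.attritionLaw μ X D R Y (Attrition.intervalScore V lo hi)) (1 - γ))
    (f : ℝ) (hf : 0 < f)
    (hdensity : HasDerivAt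
      (cdf (Attrition.attritionLaw μ X D R Y (Attrition.intervalScore V lo hi))) f η) :
    -- on every law of the model the target quantile is the functional `etaC` of the observed law
    (∀ (ν : Measure Ω) [IsProbabilityMeasure ν],
      Attrition.MissingAtRandom ν hX hD R Y → Attrition.Overlap ν X D R →
      Attrition.quantile
          (Attrition.attritionLaw ν X D R Y (Attrition.intervalScore V lo hi)) (1 - γ) =
        Attrition.etaC (Attrition.intervalScore V lo hi) (1 - γ)
          (ν.map (Attrition.observe X D R Y))) ∧
    -- and its efficient influence function is `ψ_C` up to a constant
    ∃ c : ℝ, c ≠ 0 ∧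
      Attrition.IsEfficientInfluenceFunction
        (Attrition.etaC (Attrition.intervalScore V lo hi) (1 - γ))
        (μ.map (Attrition.observe X D R Y))
        (fun o => c * Attrition.psiC (Attrition.intervalScore V lo hi)
          (μ.map (Attrition.observe X D R Y)) γ η o) := by
  have hv := Attrition.measurable_intervalScore hlo hhi hV
  have hp0 : 0 < 1 - γ := by linarith
  have hp1 : 1 - γ < 1 := by linarith
  refine ⟨fun ν _ hM hO => Attrition.quantile_attritionLaw_eq_etaC hX hD hR hY hM hO hv hp0 hp1, ?_⟩
  have hT := Attrition.measurable_observe hX hD hR hY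
  have hP : IsProbabilityMeasure (μ.map (Attrition.observe X D R Y)) :=
    Measure.isProbabilityMeasure_map hT.aemeasurable
  have hL := Attrition.isProbabilityMeasure_attritionLaw hX hD hR hY hv hoverlap
  obtain ⟨c, H⟩ := Attrition.strictOverlap_observe hX hD hR hY hoverlap
  have hident := Attrition.integral_mC_eq_attritionLaw hX hD hR hY hMAR hoverlap hv
  have hcdf : cdf (Attrition.attritionLaw μ X D R Y (Attrition.intervalScore V lo hi)) η =
      1 - γ := by
    rw [hη]
    exact Attrition.cdf_quantile_eq hp0 hp1 (hη ▸ hdensity.continuousAt)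
  -- The density is assumed for the right-continuous distribution function, whereas the strict
  -- inequality in `mC` identifies the left-continuous one.
  obtain ⟨hleft, hder⟩ := Attrition.hasDerivAt_of_leftLim hdensity
    (H := fun u => (Attrition.attritionLaw μ X D R Y
      (Attrition.intervalScore V lo hi)).real (Iio u))
    (fun u => by rw [cdf_eq_real]; exact measureReal_mono Iio_subset_Iic_self)
    (fun u w h => by rw [cdf_eq_real]; exact measureReal_mono (Iic_subset_Iio.2 h))
  simp_rw [← hident] at hder hleft
  have hpos := (H.compl Attrition.covariates_le Attrition.measurableSet_responded).measure_pos
    Attrition.covariates_le Attrition.measurableSet_responded.compl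
  exact ⟨_, div_ne_zero (neg_ne_zero.2 one_ne_zero) (mul_pos hpos hf).ne',
    Attrition.isEfficientInfluenceFunction_psiC hv H hf hder (hleft.trans hcdf)⟩
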